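/- Let $\mathbb A_f$ be the ring of finite adeles of $\mathbb Q$, i.e. the restricted product of the fields $\mathbb Q_p$ with respect to $\mathbb Z_p$ over all primes $p$. Let $\widehat{\mathbb Z}=\prod_p\mathbb Z_p\subset\mathbb A_f$, let $\widehat{\mathbb Z}^*$ be its group of units, and let $\mathbb A_f/\widehat{\mathbb Z}^*$ be the orbit space for the multiplication action, with the quotient topology. Put $$\tilde\Omega_B=\{(r,a)\mid a\in\mathbb A_f/\widehat{\mathbb Z}^*,\ r\in\mathbb A_f/a\widehat{\mathbb Z}\},\qquad \Omega_B=\{(r,a)\mid a\in\widehat{\mathbb Z}/\widehat{\mathbb Z}^*,\ r\in\widehat{\mathbb Z}/a\widehat{\mathbb Z}\}\subset\tilde\Omega_B,$$ where $\tilde\Omega_B$ carries the quotient topology from $\mathbb A_f\times(\mathbb A_f/\widehat{\mathbb Z}^*)$. Let the group $\mathbb Q\rtimes\mathbb Q^*_+$, with product $(m,k)(n,l)=(m+kn,kl)$, act on $\tilde\Omega_B$ by $(m,k)(r,a)=(m+kr,ka)$. Let $\beta\in[1,2]$. Then there is a unique Borel measure $\tilde\mu_\beta$ on $\tilde\Omega_B$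 such that $\tilde\mu_\beta(\Omega_B)=1$ and $$\tilde\mu_\beta((m,k)Y)=k^{-\beta}\,\tilde\mu_\beta(Y)\quad\text{for every Borel set } Y\subset\tilde\Omega_B \text{ and every } (m,k)\in\mathbb Q\rtimes\mathbb Q^*_+ .$$ The action of $\mathbb Q\rtimes\mathbb Q^*_+$ on $(\tilde\Omega_B,\tilde\mu_\beta)$ is ergodic (it is nonsingular, and every Borel set that is invariant under each group element up to null sets is null or conull) and essentially free (almost every point has trivial stabilizer). -/

import Mathlib

open MeasureTheory Set
open scoped RestrictedProduct symmDiff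

noncomputable section

namespace ToeplitzAffine

instance factPrime (p : Nat.Primes) : Fact (p : ℕ).Prime := ⟨p.2⟩

/-- The ring `𝔸_f` of finite adeles: the restricted product of the fields `ℚ_p` with respect to
the subrings `ℤ_p`, over all primes `p`, with the restricted product topology. -/
abbrev FinAdele : Type := Πʳ p : Nat.Primes, [ℚ_[(p : ℕ)], PadicInt.subring (p : ℕ)]

/-- The subring `Ẑ = ∏_p ℤ_p` of integral adeles. -/
def zHat : Subring FinAdele where
  carrier := {x | ∀ p : Nat.Primes, x p ∈ PadicInt.subring (p : ℕ)}
  mul_mem' hx hy p := mul_mem (hx p) (hy p)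
  one_mem' _ := one_mem _
  add_mem' hx hy p := add_mem (hx p) (hy p)
  zero_mem' _ := zero_mem _
  neg_mem' hx p := neg_mem (hx p)

/-- The group `Ẑ^*` of units of `Ẑ`, as a subgroup of the group of finite ideles. -/
def zHatUnits : Subgroup FinAdeleˣ := zHat.toSubmonoid.units

/-- The diagonal embedding of `ℚ` into `𝔸_f`. -/
def diag : ℚ →+* FinAdele where
  toFun q := RestrictedProduct.mk (fun p => (q : ℚ_[(p : ℕ)])) (by
    have hfin : {p : Nat.Primes | (p : ℕ) ∣ q.den}.Finite :=
      Set.Finite.of_injOn (f := fun p : Nat.Primes => (p : ℕ)) (t := Set.Iic q.den)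
        (fun p hp => Nat.le_of_dvd q.den_pos hp) (fun p _ p' _ h => Subtype.ext h)
        (Set.finite_Iic _)
    filter_upwards [hfin.compl_mem_cofinite] with p hp
    exact Padic.norm_rat_le_one hp)
  map_one' := by ext p; exact Rat.cast_one
  map_mul' x y := by ext p; exact Rat.cast_mul x y
  map_zero' := by ext p; exact Rat.cast_zero
  map_add' x y := by ext p; exact Rat.cast_add x y

/-- The orbit space `𝔸_f / Ẑ^*` (with the quotient topology). -/
abbrev AdeleClass : Type := MulAction.orbitRel.Quotient zHatUnits FinAdele

/-- Multiplication by an adele `x` on `𝔸_f / Ẑ^*`. -/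
def mulClass (x : FinAdele) : AdeleClass → AdeleClass :=
  Quotient.map (fun a => x * a) (by
    rintro a b ⟨u, rfl⟩
    exact ⟨u, (mul_smul_comm u x b).symm⟩)

/-- The additive subgroup `aẐ` of `𝔸_f`; it depends only on the class of `a` in `𝔸_f / Ẑ^*`. -/
def mulZHat : AdeleClass → AddSubgroup FinAdele :=
  Quotient.lift (fun a : FinAdele => zHat.toAddSubgroup.map (AddMonoidHom.mulLeft a)) (by
    have key : ∀ (u : zHatUnits) (b : FinAdele),
        zHat.toAddSubgroup.map (AddMonoidHom.mulLeft (u • b)) ≤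
          zHat.toAddSubgroup.map (AddMonoidHom.mulLeft b) := by
      rintro u b _ ⟨z, hz, rfl⟩
      refine ⟨((u : FinAdeleˣ) : FinAdele) * z, ?_, ?_⟩
      · exact zHat.mul_mem u.2.1 hz
      · change b * (((u : FinAdeleˣ) : FinAdele) * z) = (((u : FinAdeleˣ) : FinAdele) * b) * z
        ring
    rintro a b ⟨u, rfl⟩
    refine le_antisymm (key u b) ?_
    have h := key u⁻¹ (u • b)
    rwa [inv_smul_smul] at h)

/-- `(r, a) ∼ (r', a')` if and only if `a = a'` and `r - r' ∈ aẐ`. -/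
def omegaSetoid : Setoid (FinAdele × AdeleClass) where
  r x y := x.2 = y.2 ∧ x.1 - y.1 ∈ mulZHat x.2
  iseqv :=
    { refl := fun x => ⟨rfl, by simp⟩
      symm := by
        rintro ⟨r, a⟩ ⟨r', a'⟩ ⟨h, h'⟩
        obtain rfl : a = a' := h
        exact ⟨rfl, by simpa using neg_mem h'⟩
      trans := by
        rintro ⟨r, a⟩ ⟨r', a'⟩ ⟨r'', a''⟩ ⟨h, h'⟩ ⟨k, k'⟩
        obtain rfl : a = a' := h
        obtain rfl : a = a'' := k
        exact ⟨rfl, by simpa using add_mem h' k'⟩ }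

/-- The space `Ω̃_B = {(r, a) | a ∈ 𝔸_f / Ẑ^*, r ∈ 𝔸_f / aẐ}`, as a quotient of
`𝔸_f × (𝔸_f / Ẑ^*)`. -/
def OmegaTildeB : Type := Quotient omegaSetoid

/-- The quotient topology. -/
instance : TopologicalSpace OmegaTildeB :=
  inferInstanceAs (TopologicalSpace (Quotient omegaSetoid))

/-- The Borel σ-algebra. -/
instance : MeasurableSpace OmegaTildeB := borel OmegaTildeB

instance : BorelSpace OmegaTildeB := ⟨rfl⟩

/-- The point `(r, a)` of `Ω̃_B` determined by `r ∈ 𝔸_f` and `a ∈ 𝔸_f / Ẑ^*`. -/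
def OmegaTildeB.mk (r : FinAdele) (a : AdeleClass) : OmegaTildeB :=
  Quotient.mk omegaSetoid (r, a)

/-- The subset `Ω_B = {(r, a) | a ∈ Ẑ / Ẑ^*, r ∈ Ẑ / aẐ}` of `Ω̃_B`. -/
def omegaB : Set OmegaTildeB :=
  {ω | ∃ r ∈ zHat, ∃ a ∈ zHat, ω = OmegaTildeB.mk r (Quotient.mk _ a)}

/-- The multiplication action of the group `ℚ^*_+` of positive rationals on `(ℚ, +)`. -/
def posAct : Units.posSubgroup ℚ →* MulAut (Multiplicative ℚ) where
  toFun k := AddEquiv.toMultiplicative (DistribMulAction.toAddEquiv ℚ k)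
  map_one' := by
    ext m; exact congrArg Multiplicative.ofAdd (one_smul (Units.posSubgroup ℚ) m.toAdd)
  map_mul' k l := by
    ext m; exact congrArg Multiplicative.ofAdd (mul_smul k l m.toAdd)

/-- The group `ℚ ⋊ ℚ^*_+`, with product `(m, k) (n, l) = (m + k n, k l)`. -/
abbrev AffQ : Type := Multiplicative ℚ ⋊[posAct] Units.posSubgroup ℚ

/-- The component `m ∈ ℚ` of `(m, k)`. -/
def AffQ.m (g : AffQ) : ℚ := g.left.toAdd

/-- The component `k ∈ ℚ^*_+` of `(m, k)`, as a rational number. -/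
def AffQ.k (g : AffQ) : ℚ := ((g.right : ℚˣ) : ℚ)

theorem AffQ.one_m : AffQ.m 1 = 0 := rfl

theorem AffQ.one_k : AffQ.k 1 = 1 := rfl

theorem AffQ.mul_m (g h : AffQ) : (g * h).m = g.m + g.k * h.m := rfl

theorem AffQ.mul_k (g h : AffQ) : (g * h).k = g.k * h.k := rfl

theorem AffQ.k_pos (g : AffQ) : 0 < g.k := g.right.2

theorem mul_mem_mulZHat (x : FinAdele) (a : AdeleClass) {r : FinAdele} (h : r ∈ mulZHat a) :
    x * r ∈ mulZHat (mulClass x a) := by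
  induction a using Quotient.inductionOn with
  | h a =>
    obtain ⟨z, hz, rfl⟩ := h
    exact ⟨z, hz, mul_assoc x a z⟩

/-- The action of `ℚ ⋊ ℚ^*_+` on `Ω̃_B`: `(m, k) (r, a) = (m + k r, k a)`. -/
def affAct (g : AffQ) : OmegaTildeB → OmegaTildeB :=
  Quotient.map (sa := omegaSetoid) (sb := omegaSetoid)
    (fun x => (diag g.m + diag g.k * x.1, mulClass (diag g.k) x.2)) (by
      rintro ⟨r, a⟩ ⟨r', a'⟩ ⟨h, h'⟩
      obtain rfl : a = a' := h
      refine ⟨rfl, ?_⟩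
      have := mul_mem_mulZHat (diag g.k) a h'
      rw [mul_sub] at this
      simpa using this)

theorem mulClass_one (a : AdeleClass) : mulClass 1 a = a := by
  induction a using Quotient.inductionOn with
  | h a => exact congrArg (Quotient.mk _) (one_mul a)

theorem mulClass_mul (x y : FinAdele) (a : AdeleClass) :
    mulClass (x * y) a = mulClass x (mulClass y a) := by
  induction a using Quotient.inductionOn with
  | h a => exact congrArg (Quotient.mk _) (mul_assoc x y a)

instance : MulAction AffQ OmegaTildeB where
  smul := affAct
  one_smul ω := by
    induction ω using Quotient.inductionOn with
    | h x =>
      refine congrArg (Quotient.mk omegaSetoid) (Prod.ext ?_ ?_)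
      · simp [AffQ.one_m, AffQ.one_k]
      · simp [AffQ.one_k, mulClass_one]
  mul_smul g h ω := by
    induction ω using Quotient.inductionOn with
    | h x =>
      refine congrArg (Quotient.mk omegaSetoid) (Prod.ext ?_ ?_)
      · simp only [AffQ.mul_m, AffQ.mul_k, map_add, map_mul]; ring
      · simp only [AffQ.mul_k, map_mul, mulClass_mul]

theorem smul_mk (g : AffQ) (r : FinAdele) (a : AdeleClass) :
    g • OmegaTildeB.mk r a =
      OmegaTildeB.mk (diag g.m + diag g.k * r) (mulClass (diag g.k) a) := rfl

/-- `μ` is the measure `μ̃_β`: a Borel measure on `Ω̃_B` with `μ(Ω_B) = 1` and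
`μ((m, k) Y) = k^{-β} μ(Y)` for all Borel sets `Y` and all `(m, k) ∈ ℚ ⋊ ℚ^*_+`. -/
structure IsMuTilde (β : ℝ) (μ : Measure OmegaTildeB) : Prop where
  normalized : μ omegaB = 1
  scaling : ∀ (g : AffQ) (Y : Set OmegaTildeB), MeasurableSet Y →
    μ ((fun ω => g • ω) '' Y) = ENNReal.ofReal ((g.k : ℝ) ^ (-β)) * μ Y

/-- Ergodicity of a nonsingular action: the group acts by measurable transformations that
preserve the class of null sets, and every measurable set that is invariant up to null sets
is null or conull. -/
structure IsErgodicAction (G : Type*) {X : Type*} [Group G] [MulAction G X] [MeasurableSpace X]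
    (μ : Measure X) : Prop where
  nonsingular : ∀ g : G, Measure.QuasiMeasurePreserving (fun x : X => g • x) μ μ
  null_or_conull : ∀ A : Set X, MeasurableSet A →
    (∀ g : G, μ (((fun x : X => g • x) ⁻¹' A) ∆ A) = 0) → μ A = 0 ∨ μ Aᶜ = 0

/-- Essential freeness: almost every point has trivial stabilizer. -/
def IsEssentiallyFree (G : Type*) {X : Type*} [Group G] [MulAction G X] [MeasurableSpace X]
    (μ : Measure X) : Prop :=
  ∀ᵐ x ∂μ, MulAction.stabilizer G x = ⊥

end ToeplitzAffine

end

noncomputable section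

namespace ToeplitzAffine

/-! Everything is read off from the translates of Ω_B. The translate by (m, k) is the `cell` {(r, a)
| a ∈ kẐ, r ∈ m + kẐ}. Cells are compact open, they separate points, two of them are disjoint or
meet in a cell (`cell_inter`), and they generate the Borel sets (`borel_eq_generateFrom_cell`). The
scaling condition is therefore equivalent to giving the cell of (m, k) mass k^{-β}, and this
determines the measure (`ext_of_cell`, `isMuTilde_of_cell`).

Ergodicity is a consequence of uniqueness: the restriction of the measure to an almost invariant set
A scales in the same way, so it is c·μ with c = μ(Ω_B ∩ A); evaluating at the complement of A gives
c = 0 or a conull A.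

For existence (β ≥ 1), let r be Haar distributed on Ẑ and a = ∏ p^{θ_p} with independent geometric
exponents, so that n divides a with probability n^{-(β-1)}; a cell of modulus n inside Ω_B then has
mass n^{-1}·n^{-(β-1)} (`exists_isMuTilde`). The resulting measure on Ω_B is spread over an
increasing exhaustion by cells (`exists_isMuTilde_of_finite`).

For freeness, the event n ∣ a in Ω_B has mass n^{1-β}. If 1 < β ≤ 2, almost surely a vanishes at no
prime, and since ∑ p^{1-β} diverges, the second Borel–Cantelli lemma gives infinitely many primes
dividing a. An element (m, k) fixing such a point has k = 1 and m divisible by infinitely many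
integers, so m = 0. If β = 1, almost surely a = 0 and r is not rational, which again excludes
nontrivial stabilizers. -/

/-! ### Divisibility and rational approximation in the finite adeles -/

theorem mem_zHat {x : FinAdele} : x ∈ zHat ↔ ∀ p : Nat.Primes, ‖x p‖ ≤ 1 := Iff.rfl

@[simp] theorem diag_apply (q : ℚ) (p : Nat.Primes) : diag q p = (q : ℚ_[(p : ℕ)]) := rfl

theorem norm_nat_le (p : ℕ) [Fact p.Prime] (n : ℕ) : ‖(n : ℚ_[p])‖ ≤ 1 := by
  exact_mod_cast Padic.norm_int_le_one (p := p) n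

theorem mul_apply' (x y : FinAdele) (p : Nat.Primes) : (x * y) p = x p * y p := rfl

theorem diag_injective : Function.Injective diag := by
  intro a b h
  have p : Nat.Primes := ⟨2, Nat.prime_two⟩
  have h2 : (a : ℚ_[(p : ℕ)]) = b := congrArg (fun x : FinAdele => x p) h
  exact_mod_cast h2

/-- A rational number is an integral adele if and only if it is an integer. -/
theorem diag_mem_zHat {q : ℚ} : diag q ∈ zHat ↔ ∃ n : ℤ, q = n := by
  constructor
  · intro h
    have hd : q.den = 1 := by
      by_contra hne
      obtain ⟨p, hp, hpd⟩ := Nat.exists_prime_and_dvd hne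
      have := Fact.mk hp
      have h1 : ‖(q : ℚ_[p])‖ ≤ 1 := h ⟨p, hp⟩
      have hn : ¬ p ∣ q.num.natAbs := fun hpn =>
        hp.one_lt.ne' (Nat.dvd_one.1 (q.reduced ▸ Nat.dvd_gcd hpn hpd))
      have h2 : ‖((q.num : ℤ) : ℚ_[p])‖ = 1 := by
        refine le_antisymm (Padic.norm_int_le_one _) (not_lt.1 fun hlt => hn ?_)
        exact Int.natCast_dvd.1 ((Padic.norm_intCast_lt_one_iff (k := q.num)).1 hlt)
      have h3 : ‖((q.den : ℤ) : ℚ_[p])‖ < 1 :=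
        (Padic.norm_intCast_lt_one_iff (k := (q.den : ℤ))).2 (by exact_mod_cast hpd)
      have h4 : (q : ℚ_[p]) * ((q.den : ℤ) : ℚ_[p]) = ((q.num : ℤ) : ℚ_[p]) := by
        have := Rat.mul_den_eq_num q
        exact_mod_cast congrArg (fun t : ℚ => (t : ℚ_[p])) this
      have h5 := congrArg norm h4
      rw [norm_mul, h2] at h5
      nlinarith [norm_nonneg (q : ℚ_[p]), norm_nonneg ((q.den : ℤ) : ℚ_[p])]
    exact ⟨q.num, ((Rat.den_eq_one_iff q).1 hd).symm⟩
  · rintro ⟨n, rfl⟩ p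
    change ‖(((n : ℚ)) : ℚ_[(p : ℕ)])‖ ≤ 1
    rw [Rat.cast_intCast]
    exact Padic.norm_int_le_one _

theorem diag_int_mem (n : ℤ) : diag (n : ℚ) ∈ zHat := diag_mem_zHat.2 ⟨n, rfl⟩

theorem diag_nat_mem (n : ℕ) : diag (n : ℚ) ∈ zHat := diag_mem_zHat.2 ⟨n, by simp⟩

/-- Every finite adele has a denominator. -/
theorem exists_denominator (x : FinAdele) : ∃ D : ℕ, 0 < D ∧ diag (D : ℚ) * x ∈ zHat := by
  classical
  have hfin : {p : Nat.Primes | ¬ ‖x p‖ ≤ 1}.Finite := x.2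
  have hex : ∀ p : Nat.Primes, ∃ e : ℕ, ‖x p‖ ≤ ((p : ℕ) : ℝ) ^ e := fun p => by
    obtain ⟨e, he⟩ := pow_unbounded_of_one_lt ‖x p‖
      (by exact_mod_cast p.2.one_lt : (1 : ℝ) < ((p : ℕ) : ℝ))
    exact ⟨e, he.le⟩
  choose e he using hex
  refine ⟨∏ p ∈ hfin.toFinset, (p : ℕ) ^ e p,
    Finset.prod_pos fun p _ => pow_pos p.2.pos _, fun p => ?_⟩
  change ‖(((∏ p ∈ hfin.toFinset, (p : ℕ) ^ e p : ℕ) : ℚ) : ℚ_[(p : ℕ)]) * x p‖ ≤ 1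
  rw [Rat.cast_natCast, norm_mul]
  by_cases hp : ‖x p‖ ≤ 1
  · exact mul_le_one₀ (norm_nat_le _ _) (norm_nonneg _) hp
  · have hmem : p ∈ hfin.toFinset := by simpa using hp
    rw [← Finset.mul_prod_erase _ _ hmem, Nat.cast_mul, norm_mul, Nat.cast_pow, norm_pow,
      Padic.norm_p]
    have h1 : ‖((∏ q ∈ hfin.toFinset.erase p, (q : ℕ) ^ e q : ℕ) : ℚ_[(p : ℕ)])‖ ≤ 1 :=
      norm_nat_le _ _
    have hpos : (0 : ℝ) < ((p : ℕ) : ℝ) ^ e p := pow_pos (by exact_mod_cast p.2.pos) _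
    calc _ ≤ (((p : ℕ) : ℝ)⁻¹ ^ e p * 1) * ((p : ℕ) : ℝ) ^ e p := by
          gcongr
          exact he p
      _ = 1 := by rw [inv_pow]; field_simp

/-- `x ∈ k Ẑ`. -/
def MemMul (k : ℚ) (x : FinAdele) : Prop := diag k⁻¹ * x ∈ zHat

theorem memMul_one {x : FinAdele} : MemMul 1 x ↔ x ∈ zHat := by simp [MemMul]

theorem memMul_iff_norm {k : ℚ} {x : FinAdele} (hk : k ≠ 0) :
    MemMul k x ↔ ∀ p : Nat.Primes, ‖x p‖ ≤ ‖(k : ℚ_[(p : ℕ)])‖ := by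
  refine forall_congr' fun p => ?_
  change ‖((k⁻¹ : ℚ) : ℚ_[(p : ℕ)]) * x p‖ ≤ 1 ↔ _
  have : 0 < ‖(k : ℚ_[(p : ℕ)])‖ := norm_pos_iff.2 (by exact_mod_cast hk)
  rw [norm_mul, Rat.cast_inv, norm_inv, inv_mul_le_iff₀ this, mul_one]

theorem MemMul.sub {k : ℚ} {x y : FinAdele} (hx : MemMul k x) (hy : MemMul k y) :
    MemMul k (x - y) := by
  unfold MemMul; rw [mul_sub]; exact sub_mem hx hy

theorem MemMul.add {k : ℚ} {x y : FinAdele} (hx : MemMul k x) (hy : MemMul k y) :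
    MemMul k (x + y) := by
  unfold MemMul; rw [mul_add]; exact add_mem hx hy

theorem memMul_mul {k l : ℚ} {x : FinAdele} (hl : l ≠ 0) :
    MemMul (l * k) (diag l * x) ↔ MemMul k x := by
  unfold MemMul
  rw [← mul_assoc, ← map_mul]
  congr! 3
  field_simp

theorem memMul_diag {k q : ℚ} (hk : k ≠ 0) : MemMul k (diag q) ↔ ∃ n : ℤ, q = k * n := by
  unfold MemMul
  rw [← map_mul, diag_mem_zHat]
  refine exists_congr fun n => ?_
  rw [inv_mul_eq_iff_eq_mul₀ hk]

/-- The integers are dense in the integral adeles. -/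
theorem exists_nat_memMul_sub (n : ℕ) (hn : n ≠ 0) :
    ∀ x ∈ zHat, ∃ c : ℕ, MemMul n (x - diag c) := by
  induction n using Nat.recOnMul with
  | zero => exact absurd rfl hn
  | one => intro x hx; exact ⟨0, by simpa [memMul_one] using hx⟩
  | prime p hp =>
    intro x hx
    have := Fact.mk hp
    let y : ℤ_[p] := ⟨x ⟨p, hp⟩, hx ⟨p, hp⟩⟩
    obtain ⟨c, -, hc⟩ := PadicInt.exists_mem_range y
    refine ⟨c, (memMul_iff_norm (by exact_mod_cast hn)).2 fun q => ?_⟩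
    rw [Rat.cast_natCast]
    by_cases hq : (q : ℕ) = p
    · obtain ⟨q, hq'⟩ := q
      obtain rfl : q = p := hq
      have h1 : ‖y - (c : ℤ_[q])‖ < 1 := PadicInt.mem_nonunits.1 hc
      rw [PadicInt.norm_lt_one_iff_dvd] at h1
      obtain ⟨z, hz⟩ := h1
      have h3 : ‖y - (c : ℤ_[q])‖ ≤ ‖(q : ℚ_[q])‖ := by
        rw [hz, norm_mul]
        refine (mul_le_of_le_one_right (norm_nonneg _) z.norm_le_one).trans_eq ?_
        simp
      have h2 : (x - diag c) ⟨q, hq'⟩ = ((y - (c : ℤ_[q]) : ℤ_[q]) : ℚ_[q]) := by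
        rw [PadicInt.coe_sub]
        change x ⟨q, hq'⟩ - (((c : ℚ)) : ℚ_[q]) = x ⟨q, hp⟩ - ((c : ℤ_[q]) : ℚ_[q])
        simp
      rw [h2]
      exact h3
    · have h1 : ‖((p : ℕ) : ℚ_[(q : ℕ)])‖ = 1 := by
        refine le_antisymm (norm_nat_le _ _) (not_lt.1 fun hlt => hq ?_)
        have := (Padic.norm_intCast_lt_one_iff (p := (q : ℕ)) (k := (p : ℤ))).1 (by exact_mod_cast hlt)
        exact (Nat.prime_dvd_prime_iff_eq q.2 hp).1 (by exact_mod_cast this)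
      rw [h1]
      exact sub_mem hx (diag_nat_mem c) q
  | mul a b iha ihb =>
    intro x hx
    have ha : a ≠ 0 := left_ne_zero_of_mul hn
    have hb : b ≠ 0 := right_ne_zero_of_mul hn
    obtain ⟨c, hc⟩ := iha ha x hx
    obtain ⟨d, hd⟩ := ihb hb _ hc
    -- Mixed radix expansion: c is the digit modulo a, and d approximates (x - c)/a modulo b.
    refine ⟨c + a * d, ?_⟩
    have ha' : (a : ℚ) ≠ 0 := by exact_mod_cast ha
    rw [← memMul_mul ha', mul_sub, ← mul_assoc, ← map_mul, ← map_mul, mul_inv_cancel₀ ha',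
      map_one, one_mul] at hd
    push_cast
    rwa [map_add, ← sub_sub]

/-- The rationals are dense in the finite adeles. -/
theorem exists_rat_memMul_sub (k : ℚ) (hk : k ≠ 0) (r : FinAdele) :
    ∃ m : ℚ, MemMul k (r - diag m) := by
  obtain ⟨D, hD, h⟩ := exists_denominator (diag k⁻¹ * r)
  obtain ⟨c, hc⟩ := exists_nat_memMul_sub D hD.ne' _ h
  have hD' : (D : ℚ) ≠ 0 := by exact_mod_cast hD.ne'
  have hkD : k / D ≠ 0 := div_ne_zero hk hD'
  -- Here c approximates D k⁻¹ r modulo D; rescaling by k/D turns the error into an element of kẐ.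
  refine ⟨k / D * c, ?_⟩
  rw [← memMul_mul hkD, div_mul_cancel₀ _ hD', mul_sub, ← mul_assoc, ← mul_assoc, ← map_mul,
    ← map_mul, ← map_mul] at hc
  convert hc using 1
  have : k / D * D * k⁻¹ = 1 := by field_simp
  rw [this, map_one, one_mul]

/-- Two fractional ideals of `𝔸_f` generated by rationals have a least common multiple. -/
theorem exists_lcm (k l : ℚ) (hk : 0 < k) (hl : 0 < l) :
    ∃ c : ℚ, 0 < c ∧ ∀ x, MemMul c x ↔ MemMul k x ∧ MemMul l x := by
  have hq : 0 < k / l := div_pos hk hl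
  set i := (k / l).num with hi
  set j := (k / l).den with hj
  have hj0 : (j : ℚ) ≠ 0 := by exact_mod_cast (k / l).den_pos.ne'
  have hi0 : (i : ℚ) ≠ 0 := by exact_mod_cast (Rat.num_pos.2 hq).ne'
  have hij : k * j = i * l := by
    have h := Rat.num_div_den (k / l)
    rw [← hi, ← hj, div_eq_div_iff hj0 hl.ne'] at h
    exact h.symm
  -- With k/l = i/j in lowest terms, the multiple is c = kj = il. A Bézout relation ui + vj = 1
  -- gives c⁻¹ = u l⁻¹ + v k⁻¹, which is the nontrivial implication.
  have hco : IsCoprime i (j : ℤ) := by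
    rw [Int.isCoprime_iff_gcd_eq_one]
    exact (k / l).reduced
  obtain ⟨u, v, huv⟩ := hco
  have huv' : (u : ℚ) * i + v * j = 1 := by exact_mod_cast huv
  refine ⟨k * j, mul_pos hk (by exact_mod_cast (k / l).den_pos), fun x => ⟨fun h => ⟨?_, ?_⟩, ?_⟩⟩
  · have := zHat.mul_mem (diag_nat_mem j) h
    unfold MemMul
    rw [← mul_assoc, ← map_mul] at this
    convert this using 3
    field_simp
  · have := zHat.mul_mem (diag_int_mem i) h
    unfold MemMul
    rw [← mul_assoc, ← map_mul] at this
    convert this using 3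
    rw [hij]; field_simp
  · rintro ⟨h1, h2⟩
    have := add_mem (zHat.mul_mem (diag_int_mem u) h2) (zHat.mul_mem (diag_int_mem v) h1)
    unfold MemMul
    rw [← mul_assoc, ← mul_assoc, ← map_mul, ← map_mul, ← add_mul, ← map_add] at this
    convert this using 3
    have hl' : l = k * j / i := by rw [hij]; field_simp
    rw [hl']
    field_simp
    linear_combination -huv'

/-- At a given prime, an adele is approximated by a rational that divides it everywhere. -/
theorem exists_memMul_norm_eq (a : FinAdele) (p : Nat.Primes) (j : ℤ)
    (h : ‖a p‖ ≤ ((p : ℕ) : ℝ) ^ (-j)) :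
    ∃ k : ℚ, 0 < k ∧ MemMul k a ∧ ‖(k : ℚ_[(p : ℕ)])‖ = ((p : ℕ) : ℝ) ^ (-j) := by
  obtain ⟨D, hD, hDa⟩ := exists_denominator a
  -- The witness is k = p^j / D', with D' the prime-to-p part of a denominator of a: D' is a unit at
  -- p, and away from p it is all that is needed to bound a.
  obtain ⟨e, D', hD', rfl⟩ := Nat.exists_eq_pow_mul_and_not_dvd hD.ne' (p : ℕ) p.2.one_lt.ne'
  have hp0 : ((p : ℕ) : ℚ) ≠ 0 := by exact_mod_cast p.2.ne_zero
  have hD0 : (0 : ℚ) < D' := by exact_mod_cast Nat.pos_of_mul_pos_left hD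
  have hk : (0 : ℚ) < ((p : ℕ) : ℚ) ^ j / D' :=
    div_pos (zpow_pos (by exact_mod_cast p.2.pos) _) hD0
  have hnorm : ‖((((p : ℕ) : ℚ) ^ j / D' : ℚ) : ℚ_[(p : ℕ)])‖ = ((p : ℕ) : ℝ) ^ (-j) := by
    have h1 : ‖((D' : ℕ) : ℚ_[(p : ℕ)])‖ = 1 := by
      refine le_antisymm (norm_nat_le _ _) (not_lt.1 fun hlt => hD' ?_)
      have := (Padic.norm_intCast_lt_one_iff (p := (p : ℕ)) (k := (D' : ℤ))).1 (by exact_mod_cast hlt)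
      exact_mod_cast this
    push_cast
    rw [norm_div, h1, div_one, Padic.norm_p_zpow]
  refine ⟨_, hk, (memMul_iff_norm hk.ne').2 fun q => ?_, hnorm⟩
  by_cases hq : q = p
  · subst hq; rw [hnorm]; exact h
  · have h1 : ‖((p : ℕ) : ℚ_[(q : ℕ)])‖ = 1 := by
      refine le_antisymm (norm_nat_le _ _) (not_lt.1 fun hlt => hq ?_)
      have := (Padic.norm_intCast_lt_one_iff (p := (q : ℕ)) (k := (p : ℤ))).1 (by exact_mod_cast hlt)
      exact Subtype.ext ((Nat.prime_dvd_prime_iff_eq q.2 p.2).1 (by exact_mod_cast this))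
    have h2 := hDa q
    change ‖((((p : ℕ) ^ e * D' : ℕ) : ℚ) : ℚ_[(q : ℕ)]) * a q‖ ≤ 1 at h2
    push_cast at h2 ⊢
    rw [norm_mul, norm_mul, norm_pow, h1, one_pow, one_mul] at h2
    rw [norm_div, norm_zpow, h1, one_zpow, le_div_iff₀ (norm_pos_iff.2 _), mul_comm]
    · exact h2
    · exact_mod_cast hD0.ne'

/-! ### Coordinates on the quotient space -/

/-- The class of an adele modulo `Ẑ^*`. -/
def cls (a : FinAdele) : AdeleClass := Quotient.mk _ a

theorem exists_mk_eq (ω : OmegaTildeB) : ∃ r a, ω = OmegaTildeB.mk r (cls a) := by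
  induction ω using Quotient.inductionOn with
  | h x =>
    obtain ⟨r, a⟩ := x
    induction a using Quotient.inductionOn with
    | h a => exact ⟨r, a, rfl⟩

theorem norm_zHatUnits (u : zHatUnits) (p : Nat.Primes) :
    ‖((u : FinAdeleˣ) : FinAdele) p‖ = 1 := by
  have h1 := mem_zHat.1 u.2.1 p
  have h2 := mem_zHat.1 u.2.2 p
  have h3 : ((u : FinAdeleˣ) : FinAdele) p * (((u : FinAdeleˣ)⁻¹ : FinAdeleˣ) : FinAdele) p = 1 := by
    rw [← mul_apply', Units.mul_inv]; rfl
  have h4 := congrArg norm h3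
  rw [norm_mul, norm_one] at h4
  refine le_antisymm h1 (not_lt.1 fun hlt => ?_)
  have : (0 : ℝ) ≤ ‖((u : FinAdeleˣ) : FinAdele) p‖ := norm_nonneg _
  change ‖((((u : FinAdeleˣ)⁻¹ : FinAdeleˣ) : FinAdele)) p‖ ≤ 1 at h2
  nlinarith

/-- Two adeles have the same class if and only if they have the same norm at each prime. -/
theorem cls_eq_cls {a b : FinAdele} : cls a = cls b ↔ ∀ p, ‖a p‖ = ‖b p‖ := by
  constructor
  · intro h p
    obtain ⟨u, rfl⟩ := Quotient.exact h
    change ‖((u : FinAdeleˣ) : FinAdele) p * b p‖ = ‖b p‖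
    rw [norm_mul, norm_zHatUnits, one_mul]
  · intro h
    classical
    -- Where both adeles vanish any local unit will do; the value 1 keeps `F a b` and `F b a`
    -- inverse to each other.
    let f (x y : FinAdele) (p : Nat.Primes) : ℚ_[(p : ℕ)] := if x p = 0 then 1 else x p / y p
    have hf : ∀ x y : FinAdele, (∀ p, ‖x p‖ = ‖y p‖) → ∀ p, ‖f x y p‖ ≤ 1 := by
      intro x y hxy p
      by_cases h0 : x p = 0
      · simp [f, h0]
      · simp only [f, if_neg h0]
        rw [norm_div, ← hxy p, div_self (norm_ne_zero_iff.2 h0)]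
    let F (x y : FinAdele) (hxy : ∀ p, ‖x p‖ = ‖y p‖) : FinAdele :=
      RestrictedProduct.mk (f x y) (Filter.Eventually.of_forall (hf x y hxy))
    have hF : ∀ x y hxy hyx, F x y hxy * F y x hyx = 1 := by
      intro x y hxy hyx
      ext p
      change f x y p * f y x p = 1
      by_cases h0 : x p = 0
      · have h1 : y p = 0 := by rw [← norm_eq_zero, ← hxy p, h0, norm_zero]
        simp [f, h0, h1]
      · have h1 : y p ≠ 0 := by rwa [← norm_ne_zero_iff, ← hxy p, norm_ne_zero_iff]
        simp only [f, if_neg h0, if_neg h1]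
        field_simp
    have h' : ∀ p, ‖b p‖ = ‖a p‖ := fun p => (h p).symm
    let u : FinAdeleˣ := ⟨F a b h, F b a h', hF a b h h', hF b a h' h⟩
    refine Quotient.sound ⟨⟨u, ⟨hf a b h, hf b a h'⟩⟩, ?_⟩
    ext p
    change f a b p * b p = a p
    by_cases h0 : a p = 0
    · have h1 : b p = 0 := by rw [← norm_eq_zero, ← h p, h0, norm_zero]
      rw [h0, h1, mul_zero]
    · have h1 : b p ≠ 0 := by rwa [← norm_ne_zero_iff, ← h p, norm_ne_zero_iff]
      simp only [f, if_neg h0]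
      field_simp

theorem mem_mulZHat_cls {a x : FinAdele} : x ∈ mulZHat (cls a) ↔ ∃ z ∈ zHat, a * z = x := Iff.rfl

/-- Ideals of ℤ_p are balls, so both the class of a and membership in aẐ can be tested by norms,
prime by prime. Where a vanishes, the convention x / 0 = 0 supplies the required integral quotient.
-/
theorem mk_eq_mk {r r' a a' : FinAdele} :
    OmegaTildeB.mk r (cls a) = OmegaTildeB.mk r' (cls a') ↔
      (∀ p, ‖a p‖ = ‖a' p‖) ∧ ∀ p, ‖r p - r' p‖ ≤ ‖a p‖ := by
  have h1 : OmegaTildeB.mk r (cls a) = OmegaTildeB.mk r' (cls a') ↔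
      cls a = cls a' ∧ r - r' ∈ mulZHat (cls a) := Quotient.eq (r := omegaSetoid)
  rw [h1, cls_eq_cls, mem_mulZHat_cls]
  refine and_congr_right fun _ => ⟨?_, fun h => ?_⟩
  · rintro ⟨z, hz, h⟩ p
    have : r p - r' p = a p * z p := (congrArg (fun x : FinAdele => x p) h).symm
    rw [this, norm_mul]
    exact mul_le_of_le_one_right (norm_nonneg _) (hz p)
  · have hz : ∀ p, ‖(r p - r' p) / a p‖ ≤ 1 := fun p => by
      rw [norm_div]; exact div_le_one_of_le₀ (h p) (norm_nonneg _)
    refine ⟨RestrictedProduct.mk (fun p => (r p - r' p) / a p) (Filter.Eventually.of_forall hz),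
      hz, ?_⟩
    ext p
    change a p * ((r p - r' p) / a p) = r p - r' p
    by_cases h0 : a p = 0
    · have := h p
      rw [h0, norm_zero, norm_le_zero_iff] at this
      rw [this, zero_div, mul_zero]
    · field_simp

theorem mk_mem_omegaB {r a : FinAdele} :
    OmegaTildeB.mk r (cls a) ∈ omegaB ↔ r ∈ zHat ∧ a ∈ zHat := by
  refine ⟨?_, fun h => ⟨r, h.1, a, h.2, rfl⟩⟩
  rintro ⟨r', hr', a', ha', h⟩
  obtain ⟨h1, h2⟩ := mk_eq_mk.1 h
  have ha : a ∈ zHat := fun p => by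
    change ‖a p‖ ≤ 1
    rw [h1]; exact ha' p
  have hr : r - r' ∈ zHat := fun p => (h2 p).trans (ha p)
  exact ⟨by simpa using add_mem hr hr', ha⟩

/-! ### The translates of Ω_B -/

/-- The element `(m, k)` of `ℚ ⋊ ℚ^*_+`. -/
def aff (m k : ℚ) (hk : 0 < k) : AffQ :=
  ⟨Multiplicative.ofAdd m, ⟨Units.mk0 k hk.ne', hk⟩⟩

@[simp] theorem aff_m (m k : ℚ) (hk : 0 < k) : (aff m k hk).m = m := rfl

@[simp] theorem aff_k (m k : ℚ) (hk : 0 < k) : (aff m k hk).k = k := rfl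

theorem affQ_ext {g h : AffQ} (hm : g.m = h.m) (hk : g.k = h.k) : g = h :=
  SemidirectProduct.ext hm (Subtype.ext (Units.ext hk))

theorem inv_k (g : AffQ) : (g⁻¹).k = g.k⁻¹ := by
  refine eq_inv_of_mul_eq_one_left ?_
  rw [← AffQ.mul_k, inv_mul_cancel, AffQ.one_k]

theorem inv_m (g : AffQ) : (g⁻¹).m = -(g.k⁻¹ * g.m) := by
  have h : (g⁻¹ * g).m = 0 := by rw [inv_mul_cancel, AffQ.one_m]
  rw [AffQ.mul_m, inv_k] at h
  linarith

instance : Countable AffQ :=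
  Function.Injective.countable (f := fun g : AffQ => (g.m, g.k)) fun _ _ h =>
    affQ_ext (Prod.ext_iff.1 h).1 (Prod.ext_iff.1 h).2

/-- The translate `(m, k) Ω_B = {(r, a) | a ∈ k Ẑ, r ∈ m + k Ẑ}`. -/
def cell (g : AffQ) : Set OmegaTildeB := {ω | g⁻¹ • ω ∈ omegaB}

theorem cell_one : cell 1 = omegaB := by
  ext ω; simp [cell]

theorem image_smul_eq (g : AffQ) (Y : Set OmegaTildeB) :
    (fun ω => g • ω) '' Y = (fun ω => g⁻¹ • ω) ⁻¹' Y := by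
  ext ω
  constructor
  · rintro ⟨η, hη, rfl⟩
    simpa using hη
  · intro h
    exact ⟨g⁻¹ • ω, h, by simp⟩

theorem preimage_smul_cell (g h : AffQ) : (fun ω => g • ω) ⁻¹' cell h = cell (g⁻¹ * h) := by
  ext ω
  simp [cell, mul_smul]

theorem image_smul_cell (g h : AffQ) : (fun ω => g • ω) '' cell h = cell (g * h) := by
  rw [image_smul_eq, preimage_smul_cell, inv_inv]

theorem mk_mem_cell {g : AffQ} {r a : FinAdele} :
    OmegaTildeB.mk r (cls a) ∈ cell g ↔ MemMul g.k (r - diag g.m) ∧ MemMul g.k a := by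
  have h : g⁻¹ • OmegaTildeB.mk r (cls a) =
      OmegaTildeB.mk (diag (g⁻¹).m + diag (g⁻¹).k * r) (cls (diag (g⁻¹).k * a)) := rfl
  change g⁻¹ • OmegaTildeB.mk r (cls a) ∈ omegaB ↔ _
  rw [h, mk_mem_omegaB, inv_k, inv_m]
  unfold MemMul
  rw [mul_sub, map_neg, map_mul, neg_add_eq_sub]

/-- Intersecting cosets of kẐ and lẐ meet in a coset of their least common multiple cẐ. Density of ℚ
allows a rational representative m close to a common point. -/
theorem cell_inter {g h : AffQ} (hne : (cell g ∩ cell h).Nonempty) :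
    ∃ l, cell g ∩ cell h = cell l := by
  obtain ⟨ω, hg, hh⟩ := hne
  obtain ⟨r, a, rfl⟩ := exists_mk_eq ω
  rw [mk_mem_cell] at hg hh
  obtain ⟨c, hc, hlcm⟩ := exists_lcm g.k h.k g.k_pos h.k_pos
  obtain ⟨m, hm⟩ := exists_rat_memMul_sub c hc.ne' r
  have hm' := (hlcm _).1 hm
  refine ⟨aff m c hc, ?_⟩
  have key : ∀ {k n : ℚ} {s : FinAdele}, MemMul k (r - diag n) → MemMul k (r - diag m) →
      (MemMul k (s - diag n) ↔ MemMul k (s - diag m)) := by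
    intro k n s h1 h2
    constructor <;> intro h3
    · have := (h3.sub h1).add h2
      convert this using 1; ring
    · have := (h3.sub h2).add h1
      convert this using 1; ring
  ext η
  obtain ⟨s, b, rfl⟩ := exists_mk_eq η
  rw [mem_inter_iff, mk_mem_cell, mk_mem_cell, mk_mem_cell, aff_m, aff_k, hlcm, hlcm,
    key hg.1 hm'.1, key hh.1 hm'.2]
  tauto

theorem isPiSystem_range_cell : IsPiSystem (range cell) := by
  rintro _ ⟨g, rfl⟩ _ ⟨h, rfl⟩ hne
  obtain ⟨l, hl⟩ := cell_inter hne
  exact ⟨l, hl.symm⟩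

/-- The translates of `Ω_B` separate the points. -/
theorem eq_of_forall_mem_cell_iff {ω η : OmegaTildeB} (h : ∀ g, ω ∈ cell g ↔ η ∈ cell g) :
    ω = η := by
  obtain ⟨r, a, rfl⟩ := exists_mk_eq ω
  obtain ⟨r', a', rfl⟩ := exists_mk_eq η
  have step : ∀ {r a r' a' : FinAdele},
      (∀ g, OmegaTildeB.mk r (cls a) ∈ cell g → OmegaTildeB.mk r' (cls a') ∈ cell g) →
      ∀ p, ‖a' p‖ ≤ ‖a p‖ ∧ ‖r p - r' p‖ ≤ ‖a p‖ := by
    intro r a r' a' h p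
    have main : ∀ j : ℤ, ‖a p‖ ≤ ((p : ℕ) : ℝ) ^ (-j) →
        ‖a' p‖ ≤ ((p : ℕ) : ℝ) ^ (-j) ∧ ‖r p - r' p‖ ≤ ((p : ℕ) : ℝ) ^ (-j) := by
      intro j hj
      obtain ⟨k, hk, hka, hkn⟩ := exists_memMul_norm_eq a p j hj
      obtain ⟨m, hm⟩ := exists_rat_memMul_sub k hk.ne' r
      have h1 := mk_mem_cell.1 (h (aff m k hk) (mk_mem_cell.2 ⟨hm, hka⟩))
      rw [aff_m, aff_k] at h1
      rw [← hkn]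
      refine ⟨(memMul_iff_norm hk.ne').1 h1.2 p, ?_⟩
      have h2 := (memMul_iff_norm hk.ne').1 (hm.sub h1.1) p
      rw [sub_sub_sub_cancel_right] at h2
      exact h2
    -- `main` compares with powers of p. A nonzero norm is such a power; a zero one is reached by
    -- letting j tend to infinity.
    by_cases h0 : a p = 0
    · have hlim : ∀ x : ℝ, (∀ j : ℤ, x ≤ ((p : ℕ) : ℝ) ^ (-j)) → x ≤ 0 := by
        intro x hx
        by_contra! hpos
        obtain ⟨n, hn⟩ := exists_pow_lt_of_lt_one hpos
          (inv_lt_one_of_one_lt₀ (by exact_mod_cast p.2.one_lt : (1 : ℝ) < ((p : ℕ) : ℝ)))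
        have := hx n
        rw [zpow_neg, zpow_natCast, ← inv_pow] at this
        linarith
      have hj : ∀ j : ℤ, ‖a p‖ ≤ ((p : ℕ) : ℝ) ^ (-j) := fun j => by
        rw [h0, norm_zero]; positivity
      rw [h0, norm_zero]
      exact ⟨hlim _ fun j => (main j (hj j)).1, hlim _ fun j => (main j (hj j)).2⟩
    · have := main (a p).valuation (Padic.norm_eq_zpow_neg_valuation h0).le
      rwa [← Padic.norm_eq_zpow_neg_valuation h0] at this
  have h1 := step fun g => (h g).1
  have h2 := step fun g => (h g).2
  exact mk_eq_mk.2 ⟨fun p => le_antisymm (h2 p).1 (h1 p).1, fun p => (h1 p).2⟩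

/-- The element `(0, 1/N!)` of `ℚ ⋊ ℚ^*_+`. -/
def facInv (N : ℕ) : AffQ := aff 0 (N.factorial : ℚ)⁻¹ (by positivity)

@[simp] theorem facInv_m (N : ℕ) : (facInv N).m = 0 := rfl

@[simp] theorem facInv_k (N : ℕ) : (facInv N).k = (N.factorial : ℚ)⁻¹ := rfl

theorem mk_mem_cell_facInv {N : ℕ} {r a : FinAdele} :
    OmegaTildeB.mk r (cls a) ∈ cell (facInv N) ↔
      diag (N.factorial : ℚ) * r ∈ zHat ∧ diag (N.factorial : ℚ) * a ∈ zHat := by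
  rw [mk_mem_cell, facInv_m, facInv_k, MemMul, MemMul, inv_inv, map_zero, sub_zero]

theorem cell_facInv_mono : Monotone fun N => cell (facInv N) := by
  intro M N h ω hω
  obtain ⟨r, a, rfl⟩ := exists_mk_eq ω
  simp only [mk_mem_cell_facInv] at hω ⊢
  obtain ⟨d, hd⟩ := Nat.factorial_dvd_factorial h
  rw [hd, mul_comm M.factorial, Nat.cast_mul, map_mul, mul_assoc, mul_assoc]
  exact ⟨mul_mem (diag_nat_mem d) hω.1, mul_mem (diag_nat_mem d) hω.2⟩

theorem iUnion_cell_facInv : ⋃ N, cell (facInv N) = univ := by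
  refine eq_univ_of_forall fun ω => mem_iUnion.2 ?_
  obtain ⟨r, a, rfl⟩ := exists_mk_eq ω
  obtain ⟨D, hD, h⟩ := exists_denominator r
  obtain ⟨E, hE, h'⟩ := exists_denominator a
  have key : ∀ {n m : ℕ} {x : FinAdele}, n ∣ m → diag (n : ℚ) * x ∈ zHat →
      diag (m : ℚ) * x ∈ zHat := by
    rintro n _ x ⟨d, rfl⟩ hx
    rw [mul_comm n, Nat.cast_mul, map_mul, mul_assoc]
    exact mul_mem (diag_nat_mem d) hx
  exact ⟨D + E, mk_mem_cell_facInv.2 ⟨key (Nat.dvd_factorial hD (by omega)) h,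
    key (Nat.dvd_factorial hE (by omega)) h'⟩⟩

/-! ### Topology and Borel structure -/

theorem isOpen_subring (p : Nat.Primes) :
    IsOpen (PadicInt.subring (p : ℕ) : Set ℚ_[(p : ℕ)]) := by
  have h := (PadicInt.isOpenEmbedding_coe (p := (p : ℕ))).isOpen_range
  convert h using 1
  ext x
  exact ⟨fun hx => ⟨⟨x, hx⟩, rfl⟩, by rintro ⟨y, rfl⟩; exact y.2⟩

instance : Fact (∀ p : Nat.Primes, IsOpen (PadicInt.subring (p : ℕ) : Set ℚ_[(p : ℕ)])) :=
  ⟨isOpen_subring⟩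

theorem isClopen_zHat : IsClopen (zHat : Set FinAdele) := by
  have h : IsOpen (zHat : Set FinAdele) := RestrictedProduct.isOpen_forall_mem isOpen_subring
  exact ⟨AddSubgroup.isClosed_of_isOpen zHat.toAddSubgroup h, h⟩

theorem isCompact_zHat : IsCompact (zHat : Set FinAdele) := by
  have : ∀ p : Nat.Primes, CompactSpace (PadicInt.subring (p : ℕ)) := fun p =>
    PadicInt.compactSpace (p : ℕ)
  have h := isCompact_range (RestrictedProduct.isEmbedding_structureMap
    (R := fun p : Nat.Primes => ℚ_[(p : ℕ)])
    (A := fun p : Nat.Primes => (PadicInt.subring (p : ℕ) : Set ℚ_[(p : ℕ)]))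
    (𝓕 := Filter.cofinite)).continuous
  rwa [RestrictedProduct.range_structureMap] at h

theorem isClopen_memMul (k m : ℚ) : IsClopen {x : FinAdele | MemMul k (x - diag m)} :=
  isClopen_zHat.preimage (by fun_prop)

theorem isQuotientMap_mk_cls :
    Topology.IsQuotientMap fun x : FinAdele × FinAdele => OmegaTildeB.mk x.1 (cls x.2) := by
  have : ContinuousConstSMul zHatUnits FinAdele :=
    ⟨fun u => continuous_const.mul continuous_id⟩
  have h1 : IsOpenQuotientMap cls := MulAction.isOpenQuotientMap_quotientMk
  have h2 : Topology.IsQuotientMap fun x : FinAdele × AdeleClass => OmegaTildeB.mk x.1 x.2 :=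
    isQuotientMap_quotient_mk' (s := omegaSetoid)
  exact h2.comp (IsOpenQuotientMap.id.prodMap h1).isQuotientMap

theorem isClopen_cell (g : AffQ) : IsClopen (cell g) := by
  rw [← isQuotientMap_mk_cls.isClopen_preimage]
  have h : (fun x : FinAdele × FinAdele => OmegaTildeB.mk x.1 (cls x.2)) ⁻¹' cell g =
      (Prod.fst ⁻¹' {x | MemMul g.k (x - diag g.m)}) ∩
        (Prod.snd ⁻¹' {x | MemMul g.k (x - diag 0)}) := by
    ext x
    simp [mk_mem_cell]
  rw [h]
  exact ((isClopen_memMul _ _).preimage continuous_fst).inter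
    ((isClopen_memMul _ _).preimage continuous_snd)

theorem isCompact_cell (g : AffQ) : IsCompact (cell g) := by
  have hc : Continuous fun x : FinAdele × FinAdele =>
      OmegaTildeB.mk (diag g.m + diag g.k * x.1) (cls (diag g.k * x.2)) :=
    isQuotientMap_mk_cls.continuous.comp
      (f := fun x : FinAdele × FinAdele => (diag g.m + diag g.k * x.1, diag g.k * x.2))
      (by fun_prop)
  convert (isCompact_zHat.prod isCompact_zHat).image hc using 1
  rw [← mul_one g, ← image_smul_cell, cell_one, mul_one]
  ext ω
  constructor
  · rintro ⟨_, ⟨r, hr, a, ha, rfl⟩, rfl⟩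
    exact ⟨(r, a), ⟨hr, ha⟩, rfl⟩
  · rintro ⟨⟨r, a⟩, ⟨hr, ha⟩, rfl⟩
    exact ⟨_, ⟨r, hr, a, ha, rfl⟩, rfl⟩

/-- The translates of `Ω_B` generate the Borel sets. -/
theorem borel_eq_generateFrom_cell :
    (inferInstance : MeasurableSpace OmegaTildeB) = MeasurableSpace.generateFrom (range cell) := by
  classical
  refine le_antisymm ?_ (MeasurableSpace.generateFrom_le ?_)
  · refine (MeasurableSpace.generateFrom_le (fun U hU => ?_) :
      borel OmegaTildeB ≤ MeasurableSpace.generateFrom (range cell))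
    -- Membership in the countably many cells embeds the space continuously in a Cantor cube. The
    -- part of a compact cell outside an open U has compact, hence Borel, image there; pulling this
    -- image back expresses U through cells.
    let Φ : OmegaTildeB → AffQ → Bool := fun ω g => decide (ω ∈ cell g)
    have hΦc : Continuous Φ := continuous_pi fun g => by
      refine IsLocallyConstant.continuous ?_
      refine (IsLocallyConstant.iff_continuous _).2 ?_
      refine (continuous_bool_rng true).2 ?_
      convert isClopen_cell g using 1
      ext ω; simp [Φ]
    have hΦi : Function.Injective Φ := fun ω η h =>
      eq_of_forall_mem_cell_iff fun g => by simpa [Φ] using congrFun h g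
    have hcell : ∀ g, MeasurableSet[MeasurableSpace.generateFrom (range cell)] (cell g) :=
      fun g => MeasurableSpace.measurableSet_generateFrom ⟨g, rfl⟩
    have hΦm : @Measurable _ _ (MeasurableSpace.generateFrom (range cell)) _ Φ := by
      refine @measurable_pi_lambda _ _ _ (MeasurableSpace.generateFrom (range cell)) _ _ fun g => ?_
      refine @measurable_to_bool _ (MeasurableSpace.generateFrom (range cell)) _ ?_
      convert hcell g using 1
      ext ω; simp [Φ]
    have hUN : ∀ N, MeasurableSet[MeasurableSpace.generateFrom (range cell)]
        (cell (facInv N) ∩ U) := fun N => by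
      have hK : IsClosed (Φ '' (cell (facInv N) \ U)) :=
        (((isCompact_cell _).diff hU).image hΦc).isClosed
      convert (hcell (facInv N)).diff (hΦm hK.measurableSet) using 1
      rw [hΦi.preimage_image, sdiff_sdiff_right_self]
    rw [← univ_inter U, ← iUnion_cell_facInv, iUnion_inter]
    exact MeasurableSet.iUnion hUN
  · rintro _ ⟨g, rfl⟩
    exact (isClopen_cell g).isOpen.measurableSet

theorem measurableSet_cell (g : AffQ) : MeasurableSet (cell g) := (isClopen_cell g).isOpen.measurableSet

theorem measurable_of_cell {X : Type*} [MeasurableSpace X] {f : X → OmegaTildeB}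
    (hf : ∀ g, MeasurableSet (f ⁻¹' cell g)) : Measurable f := by
  have : @Measurable _ _ _ (MeasurableSpace.generateFrom (range cell)) f :=
    measurable_generateFrom (by rintro _ ⟨g, rfl⟩; exact hf g)
  rwa [← borel_eq_generateFrom_cell] at this

theorem measurable_smul_affQ (g : AffQ) : Measurable fun ω : OmegaTildeB => g • ω :=
  measurable_of_cell fun h => by rw [preimage_smul_cell]; exact measurableSet_cell _

/-! ### Uniqueness and ergodicity -/

/-- The factor `k^{-β}` by which `(m, k)` scales the measure. -/
def scale (β : ℝ) (g : AffQ) : ENNReal := ENNReal.ofReal ((g.k : ℝ) ^ (-β))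

variable {β : ℝ}

theorem scale_mul (g h : AffQ) : scale β (g * h) = scale β g * scale β h := by
  have hg : (0 : ℝ) < (g.k : ℝ) := by exact_mod_cast g.k_pos
  have hh : (0 : ℝ) < (h.k : ℝ) := by exact_mod_cast h.k_pos
  unfold scale
  rw [AffQ.mul_k, Rat.cast_mul, Real.mul_rpow hg.le hh.le, ENNReal.ofReal_mul (by positivity)]

theorem scale_one : scale β 1 = 1 := by simp [scale, AffQ.one_k]

theorem scale_ne_top (g : AffQ) : scale β g ≠ ⊤ := ENNReal.ofReal_ne_top

/-- Cells form a generating π-system, and the cells of `facInv N` exhaust the space with finite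
measure. -/
theorem ext_of_cell {μ ν : Measure OmegaTildeB} (hfin : ∀ g, μ (cell g) ≠ ⊤)
    (h : ∀ g, μ (cell g) = ν (cell g)) : μ = ν := by
  refine Measure.ext_of_generateFrom_of_iUnion (range cell) (fun N => cell (facInv N))
    borel_eq_generateFrom_cell isPiSystem_range_cell iUnion_cell_facInv (fun N => ⟨_, rfl⟩)
    (fun N => hfin _) ?_
  rintro _ ⟨g, rfl⟩
  exact h g

theorem IsMuTilde.cell {μ : Measure OmegaTildeB} (hμ : IsMuTilde β μ) (g : AffQ) :
    μ (cell g) = scale β g := by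
  have h := hμ.scaling g (ToeplitzAffine.cell 1) (measurableSet_cell 1)
  rw [image_smul_cell, mul_one, cell_one, hμ.normalized, mul_one] at h
  exact h

/-- For fixed g, both sides of the scaling identity are measures in Y; they agree on cells because
`scale` is multiplicative. -/
theorem isMuTilde_of_cell {μ : Measure OmegaTildeB} (hμ : ∀ g, μ (cell g) = scale β g) :
    IsMuTilde β μ where
  normalized := by rw [← cell_one, hμ, scale_one]
  scaling g Y hY := by
    have h : μ.map (fun ω => g⁻¹ • ω) = scale β g • μ := by
      have hm : ∀ h, μ.map (fun ω => g⁻¹ • ω) (cell h) = scale β (g * h) := fun h => by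
        rw [Measure.map_apply (measurable_smul_affQ _) (measurableSet_cell h),
          preimage_smul_cell, inv_inv, hμ]
      refine ext_of_cell (fun h => ?_) fun h => ?_
      · rw [hm]; exact scale_ne_top _
      · rw [hm, scale_mul, Measure.smul_apply, hμ, smul_eq_mul]
    have h' := congrArg (fun ν : Measure OmegaTildeB => ν Y) h
    change μ.map (fun ω => g⁻¹ • ω) Y = (scale β g • μ) Y at h'
    rw [Measure.map_apply (measurable_smul_affQ _) hY, Measure.smul_apply, smul_eq_mul] at h'
    rw [image_smul_eq, h']
    rfl

theorem IsMuTilde.unique {μ ν : Measure OmegaTildeB} (hμ : IsMuTilde β μ) (hν : IsMuTilde β ν) :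
    μ = ν :=
  ext_of_cell (fun g => by rw [hμ.cell]; exact scale_ne_top g) fun g => by rw [hμ.cell, hν.cell]

theorem IsMuTilde.quasiMeasurePreserving {μ : Measure OmegaTildeB} (hμ : IsMuTilde β μ)
    (g : AffQ) : Measure.QuasiMeasurePreserving (fun ω : OmegaTildeB => g • ω) μ μ := by
  refine ⟨measurable_smul_affQ g, Measure.AbsolutelyContinuous.mk fun Y hY h0 => ?_⟩
  rw [Measure.map_apply (measurable_smul_affQ g) hY]
  have h := hμ.scaling g⁻¹ Y hY
  rwa [image_smul_eq, inv_inv, h0, mul_zero] at h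

/-- Ergodicity follows from uniqueness: the restriction of the measure to an almost invariant set
has the same scaling property, so it is a multiple of the measure. -/
theorem IsMuTilde.isErgodicAction {μ : Measure OmegaTildeB} (hμ : IsMuTilde β μ) :
    IsErgodicAction AffQ μ where
  nonsingular := hμ.quasiMeasurePreserving
  null_or_conull A hA hinv := by
    have hcell : ∀ g, μ.restrict A (ToeplitzAffine.cell g) = μ (omegaB ∩ A) * scale β g := by
      intro g
      have hae : (fun ω => g • ω) '' A =ᵐ[μ] A := by
        rw [image_smul_eq]
        exact measure_symmDiff_eq_zero_iff.1 (hinv g⁻¹)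
      have hsc := hμ.scaling g (ToeplitzAffine.cell 1 ∩ A) ((measurableSet_cell 1).inter hA)
      rw [image_inter (MulAction.injective g), image_smul_cell, mul_one, cell_one] at hsc
      rw [Measure.restrict_apply (measurableSet_cell g),
        ← measure_congr ((Filter.EventuallyEq.refl _ _).inter hae), hsc, mul_comm]
      rfl
    have hc : μ (omegaB ∩ A) ≠ ⊤ :=
      ne_top_of_le_ne_top (by rw [hμ.normalized]; exact ENNReal.one_ne_top)
        (measure_mono inter_subset_left)
    have h : μ.restrict A = μ (omegaB ∩ A) • μ := by
      refine ext_of_cell (fun g => ?_) fun g => ?_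
      · rw [hcell]; exact ENNReal.mul_ne_top hc (scale_ne_top g)
      · rw [hcell, Measure.smul_apply, hμ.cell, smul_eq_mul]
    by_cases h0 : μ (omegaB ∩ A) = 0
    · left
      rw [h0, zero_smul, Measure.restrict_eq_zero] at h
      exact h
    · right
      have h1 := congrArg (fun ν : Measure OmegaTildeB => ν Aᶜ) h
      change μ.restrict A Aᶜ = (μ (omegaB ∩ A) • μ) Aᶜ at h1
      rw [Measure.restrict_apply hA.compl, compl_inter_self, measure_empty, Measure.smul_apply,
        smul_eq_mul] at h1
      exact (mul_eq_zero.1 h1.symm).resolve_left h0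

/-! ### Existence -/

/-- A measure on `Ω_B` with the expected values on the translates contained in `Ω_B` extends. -/
theorem exists_isMuTilde_of_finite (μ₀ : Measure OmegaTildeB) [IsFiniteMeasure μ₀]
    (h₀ : ∀ g, cell g ⊆ omegaB → μ₀ (cell g) = scale β g) :
    ∃ μ : Measure OmegaTildeB, IsMuTilde β μ := by
  set T : ℕ → Set OmegaTildeB := fun N => cell (facInv N) with hT
  have hTm : ∀ N, MeasurableSet (T N) := fun N => measurableSet_cell _
  -- `facInv N` carries Ω_B onto `T N`, so the rescaled image of μ₀ has the right value on every
  -- cell inside `T N`.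
  let ν : ℕ → Measure OmegaTildeB := fun N =>
    scale β (facInv N) • μ₀.map (fun ω => facInv N • ω)
  have hfin : ∀ N, IsFiniteMeasure (ν N) := fun N => by
    have := Measure.isFiniteMeasure_map μ₀ (fun ω => facInv N • ω)
    exact ⟨by
      rw [Measure.smul_apply, smul_eq_mul]
      exact ENNReal.mul_lt_top (scale_ne_top _).lt_top (measure_lt_top _ _)⟩
  have hν : ∀ N g, cell g ⊆ T N → ν N (cell g) = scale β g := by
    intro N g hg
    have hsub : cell ((facInv N)⁻¹ * g) ⊆ omegaB := by
      rw [← cell_one, ← image_smul_cell, ← inv_mul_cancel (facInv N), ← image_smul_cell]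
      exact image_mono hg
    rw [Measure.smul_apply, Measure.map_apply (measurable_smul_affQ _) (measurableSet_cell g),
      preimage_smul_cell, h₀ _ hsub, smul_eq_mul, ← scale_mul, mul_inv_cancel_left]
  have hcons : ∀ N M, N ≤ M → (ν N).restrict (T N) = (ν M).restrict (T N) := by
    intro N M hNM
    refine ext_of_cell (fun g => measure_ne_top _ _) fun g => ?_
    rw [Measure.restrict_apply (measurableSet_cell g), Measure.restrict_apply (measurableSet_cell g)]
    rcases (cell g ∩ T N).eq_empty_or_nonempty with he | hne
    · rw [he, measure_empty, measure_empty]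
    · obtain ⟨l, hl⟩ := cell_inter hne
      have hlN : cell l ⊆ T N := by rw [← hl]; exact inter_subset_right
      change cell g ∩ T N = cell l at hl
      rw [hl, hν N l hlN, hν M l (hlN.trans (cell_facInv_mono hNM))]
  have hDm : ∀ N, MeasurableSet (disjointed T N) := fun N => MeasurableSet.disjointed hTm N
  refine ⟨Measure.sum fun N => (ν N).restrict (disjointed T N), isMuTilde_of_cell fun g => ?_⟩
  -- By compactness a cell lies in a single `T M`, and there all the pieces of the sum agree with `ν
  -- M`.
  obtain ⟨M, hM⟩ := (isCompact_cell g).elim_directed_cover T (fun N => (isClopen_cell _).isOpen)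
    (by rw [iUnion_cell_facInv]; exact subset_univ _) (cell_facInv_mono.directed_le)
  have hterm : ∀ N, (ν N).restrict (disjointed T N) (cell g) =
      (ν M).restrict (disjointed T N) (cell g) := by
    intro N
    rw [Measure.restrict_apply (measurableSet_cell g), Measure.restrict_apply (measurableSet_cell g)]
    rcases le_or_gt N M with hNM | hMN
    · have h := congrArg (fun μ : Measure OmegaTildeB => μ (cell g ∩ disjointed T N))
        (hcons N M hNM)
      change (ν N).restrict (T N) (cell g ∩ disjointed T N) =
        (ν M).restrict (T N) (cell g ∩ disjointed T N) at h
      rwa [Measure.restrict_apply ((measurableSet_cell g).inter (hDm N)),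
        Measure.restrict_apply ((measurableSet_cell g).inter (hDm N)), inter_assoc,
        inter_eq_left.2 (disjointed_subset T N)] at h
    · have : cell g ∩ disjointed T N = ∅ := by
        refine disjoint_iff_inter_eq_empty.1 (Disjoint.mono_left hM ?_)
        rw [disjointed_apply]
        refine disjoint_sdiff_right.mono_left (le_trans ?_ le_rfl)
        exact Finset.le_sup (f := T) (Finset.mem_Iio.2 hMN)
      rw [this, measure_empty, measure_empty]
  rw [Measure.sum_apply _ (measurableSet_cell g), tsum_congr hterm,
    ← Measure.sum_apply _ (measurableSet_cell g),
    ← Measure.restrict_iUnion (disjoint_disjointed T) hDm, iUnion_disjointed, iUnion_cell_facInv,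
    Measure.restrict_univ, hν M g hM]

instance : MeasurableSpace FinAdele := borel FinAdele

instance : BorelSpace FinAdele := ⟨rfl⟩

theorem measurableSet_memMul (k m : ℚ) : MeasurableSet {x : FinAdele | MemMul k (x - diag m)} :=
  (isClopen_memMul k m).isOpen.measurableSet

/-- The integral adeles are the union of the cosets `j + n Ẑ` with `j < n`. -/
theorem mem_zHat_iff_exists_coset {n : ℕ} (hn : n ≠ 0) {x : FinAdele} :
    x ∈ zHat ↔ ∃ j < n, MemMul n (x - diag j) := by
  have hn0 : (n : ℚ) ≠ 0 := by exact_mod_cast hn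
  constructor
  · intro hx
    obtain ⟨c, hc⟩ := exists_nat_memMul_sub n hn x hx
    refine ⟨c % n, Nat.mod_lt _ (Nat.pos_of_ne_zero hn), ?_⟩
    have hd : MemMul n (diag ((c : ℚ) - (c % n : ℕ))) := by
      rw [memMul_diag hn0]
      refine ⟨(c / n : ℕ), ?_⟩
      have h := Nat.div_add_mod c n
      generalize c / n = u at h ⊢
      generalize c % n = v at h ⊢
      rw [← h]
      push_cast
      ring
    have := hc.add hd
    rw [map_sub] at this
    convert this using 1
    ring
  · rintro ⟨j, -, hj⟩
    have h2 : x - diag j ∈ zHat := by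
      have := mul_mem (diag_nat_mem n) hj
      rwa [← mul_assoc, ← map_mul, mul_inv_cancel₀ hn0, map_one, one_mul] at this
    simpa using add_mem h2 (diag_nat_mem j)

/-- The cosets `j + n Ẑ` with `j < n` are disjoint. -/
theorem eq_of_mem_cosets {n i j : ℕ} (hi : i < n) (hj : j < n) {x : FinAdele}
    (hxi : MemMul n (x - diag i)) (hxj : MemMul n (x - diag j)) : i = j := by
  have hn0 : (n : ℚ) ≠ 0 := by exact_mod_cast (Nat.zero_lt_of_lt hi).ne'
  have h := MemMul.sub hxj hxi
  rw [sub_sub_sub_cancel_left, ← map_sub, memMul_diag hn0] at h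
  obtain ⟨z, hz⟩ := h
  have hz' : (i : ℤ) - j = n * z := by exact_mod_cast hz
  exact Nat.ModEq.eq_of_lt_of_lt ((Nat.modEq_iff_dvd).2 ⟨z, hz'⟩).symm hi hj

/-- The additive Haar measure on `𝔸_f`, normalized on `Ẑ`. -/
theorem exists_adele_measure : ∃ μ : Measure FinAdele, μ zHat = 1 ∧
    ∀ (n : ℕ) (m : ℚ), n ≠ 0 → μ {x | MemMul n (x - diag m)} = ENNReal.ofReal ((n : ℝ)⁻¹) := by
  let K : TopologicalSpace.PositiveCompacts FinAdele :=
    ⟨⟨zHat, isCompact_zHat⟩, by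
      change (interior (zHat : Set FinAdele)).Nonempty
      rw [isClopen_zHat.isOpen.interior_eq]
      exact ⟨0, zHat.zero_mem⟩⟩
  have h1 : Measure.addHaarMeasure K zHat = 1 := Measure.addHaarMeasure_self
  refine ⟨Measure.addHaarMeasure K, h1, fun n m hn => ?_⟩
  set A : ℚ → Set FinAdele := fun m => {x | MemMul n (x - diag m)}
  have hA : ∀ m, Measure.addHaarMeasure K (A m) = Measure.addHaarMeasure K (A 0) := fun m => by
    rw [← measure_preimage_add _ (diag (-m)) (A 0)]
    congr 1
    ext x
    simp [A, neg_add_eq_sub]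
  -- Ẑ consists of n disjoint translates of nẐ, which share its mass equally.
  have hunion : (zHat : Set FinAdele) = ⋃ j ∈ Finset.range n, A (j : ℕ) := by
    ext x
    simp only [mem_iUnion, Finset.mem_range, exists_prop]
    exact mem_zHat_iff_exists_coset hn
  have hdisj : (Finset.range n : Set ℕ).PairwiseDisjoint fun j : ℕ => A j := by
    intro i hi j hj hij
    exact disjoint_left.2 fun x hxi hxj => hij
      (eq_of_mem_cosets (by simpa using hi) (by simpa using hj) hxi hxj)
  rw [hunion, measure_biUnion_finset hdisj fun j _ => measurableSet_memMul _ _] at h1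
  simp only [hA] at h1
  rw [Finset.sum_const, Finset.card_range, nsmul_eq_mul] at h1
  change Measure.addHaarMeasure K (A m) = _
  rw [hA, ENNReal.ofReal_inv_of_pos (by positivity), ENNReal.ofReal_natCast]
  exact ENNReal.eq_inv_of_mul_eq_one_left (by rwa [mul_comm])

/-- This tail is the probability that p^j divides an element whose exponent at p is geometric. -/
theorem geometricMeasure_Ici (q : unitInterval) (hq : q ≠ 0) (j : ℕ) :
    ProbabilityTheory.geometricMeasure q (Ici j) = ENNReal.ofReal ((1 - q : ℝ) ^ j) := by
  have hq1 : (0 : ℝ) ≤ 1 - q := sub_nonneg.2 q.2.2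
  induction j with
  | zero =>
    have : Ici (0 : ℕ) = univ := eq_univ_of_forall fun n => Nat.zero_le n
    rw [this, measure_univ, pow_zero, ENNReal.ofReal_one]
  | succ j ih =>
    have h1 : Ici (j + 1) = Ici j \ {j} := by
      ext n; simp only [mem_Ici, mem_sdiff, mem_singleton_iff]; omega
    rw [h1, measure_sdiff (by simp) (measurableSet_singleton j).nullMeasurableSet
      (measure_ne_top _ _), ih, ProbabilityTheory.geometricMeasure_singleton hq,
      ← ENNReal.ofReal_sub _ (ProbabilityTheory.geometricMeasure_nonneg q j)]
    congr 1
    ring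

theorem norm_natCast_padic (p : Nat.Primes) {n : ℕ} (hn : n ≠ 0) :
    ‖(n : ℚ_[(p : ℕ)])‖ = ((p : ℕ) : ℝ) ^ (-(n.factorization p : ℤ)) := by
  rw [Padic.norm_eq_zpow_neg_valuation (by exact_mod_cast hn), Padic.valuation_natCast,
    Nat.factorization_def n p.2]

/-- For `s ≥ 0` there is a random element of `Ẑ` that is divisible by `n` with
probability `n^{-s}`. -/
theorem exists_random_divisor (s : ℝ) (hs : 0 ≤ s) :
    ∃ (Θ : Type) (_ : MeasurableSpace Θ) (ν : Measure Θ) (_ : IsProbabilityMeasure ν)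
      (a : Θ → FinAdele), (∀ k : ℚ, 0 < k → MeasurableSet {θ | MemMul k (a θ)}) ∧
        ∀ n : ℕ, n ≠ 0 → ν {θ | MemMul n (a θ)} = ENNReal.ofReal ((n : ℝ) ^ (-s)) := by
  -- At s = 0 the geometric parameter 1 - p^{-s} would degenerate to 0; the constant 0, divisible by
  -- every n, replaces the construction.
  rcases hs.eq_or_lt with rfl | hs
  · refine ⟨Unit, inferInstance, Measure.dirac (), inferInstance, fun _ => 0,
      fun _ _ => MeasurableSet.of_discrete, fun n _ => ?_⟩
    have : {θ : Unit | MemMul n ((fun _ => 0 : Unit → FinAdele) θ)} = univ :=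
      eq_univ_of_forall fun _ => by simp [MemMul]
    rw [this, measure_univ]
    simp
  have hpow : ∀ p : Nat.Primes, ((p : ℕ) : ℝ) ^ (-s) < 1 := fun p =>
    Real.rpow_lt_one_of_one_lt_of_neg (by exact_mod_cast p.2.one_lt) (by linarith)
  have hpow0 : ∀ p : Nat.Primes, 0 ≤ ((p : ℕ) : ℝ) ^ (-s) := fun p => by positivity
  -- With this parameter the exponent at p is at least j with probability p^{-sj}; independence over
  -- the primes yields n^{-s}.
  let q : Nat.Primes → unitInterval := fun p =>
    ⟨1 - ((p : ℕ) : ℝ) ^ (-s), by linarith [hpow p], by linarith [hpow0 p]⟩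
  have hq : ∀ p, q p ≠ 0 := fun p h => by
    have h' : 1 - ((p : ℕ) : ℝ) ^ (-s) = 0 := congrArg Subtype.val h
    linarith [hpow p]
  have hnorm : ∀ (p : Nat.Primes) (j : ℕ),
      ‖(((p : ℕ) : ℚ_[(p : ℕ)])) ^ j‖ = ((p : ℕ) : ℝ) ^ (-(j : ℤ)) := fun p j => by
    rw [norm_pow, Padic.norm_p, zpow_neg, zpow_natCast, inv_pow]
  let a : (Nat.Primes → ℕ) → FinAdele := fun θ =>
    RestrictedProduct.mk (fun p => ((p : ℕ) : ℚ_[(p : ℕ)]) ^ θ p)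
      (Filter.Eventually.of_forall fun p => by
        change ‖((p : ℕ) : ℚ_[(p : ℕ)]) ^ θ p‖ ≤ 1
        rw [norm_pow]
        exact pow_le_one₀ (norm_nonneg _) (norm_nat_le _ _))
  refine ⟨Nat.Primes → ℕ, inferInstance,
    Measure.infinitePi fun p => ProbabilityTheory.geometricMeasure (q p), inferInstance, a,
    fun k hk => ?_, fun n hn => ?_⟩
  · have : {θ | MemMul k (a θ)} = ⋂ p : Nat.Primes, (fun θ : Nat.Primes → ℕ => θ p) ⁻¹'
        {j | ‖((p : ℕ) : ℚ_[(p : ℕ)]) ^ j‖ ≤ ‖(k : ℚ_[(p : ℕ)])‖} := by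
      ext θ
      simp only [mem_ofPred_eq, memMul_iff_norm hk.ne', mem_iInter, mem_preimage]
      rfl
    rw [this]
    exact MeasurableSet.iInter fun p => measurable_pi_apply p MeasurableSet.of_discrete
  · let F : Finset Nat.Primes := n.primeFactors.subtype Nat.Prime
    have hset : {θ | MemMul n (a θ)} =
        Set.pi (F : Set Nat.Primes) fun p => Ici (n.factorization p) := by
      ext θ
      rw [mem_ofPred_eq, memMul_iff_norm (by exact_mod_cast hn)]
      have hp : ∀ p : Nat.Primes, ‖a θ p‖ ≤ ‖((n : ℚ) : ℚ_[(p : ℕ)])‖ ↔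
          n.factorization p ≤ θ p := fun p => by
        change ‖((p : ℕ) : ℚ_[(p : ℕ)]) ^ θ p‖ ≤ _ ↔ _
        rw [hnorm, Rat.cast_natCast, norm_natCast_padic p hn,
          zpow_le_zpow_iff_right₀ (by exact_mod_cast p.2.one_lt)]
        omega
      simp only [hp, Set.mem_pi, mem_Ici]
      refine ⟨fun h p _ => h p, fun h p => ?_⟩
      by_cases hpF : p ∈ F
      · exact h p hpF
      · have hpn : ¬ (p : ℕ) ∣ n := fun hd => hpF
          (Finset.mem_subtype.2 (Nat.mem_primeFactors.2 ⟨p.2, hd, hn⟩))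
        rw [Nat.factorization_eq_zero_of_not_dvd hpn]
        exact Nat.zero_le _
    rw [hset, Measure.infinitePi_pi _ fun p _ => MeasurableSet.of_discrete]
    have hterm : ∀ p ∈ F, ProbabilityTheory.geometricMeasure (q p) (Ici (n.factorization p)) =
        ENNReal.ofReal ((((p : ℕ) : ℝ) ^ n.factorization p) ^ (-s)) := fun p _ => by
      rw [geometricMeasure_Ici _ (hq p)]
      congr 1
      change (1 - (1 - ((p : ℕ) : ℝ) ^ (-s))) ^ _ = _
      rw [sub_sub_cancel, ← Real.rpow_natCast, ← Real.rpow_natCast, ← Real.rpow_mul (by positivity),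
        ← Real.rpow_mul (by positivity), mul_comm]
    rw [Finset.prod_congr rfl hterm, ← ENNReal.ofReal_prod_of_nonneg fun p _ => by positivity,
      Real.finsetProd_rpow _ _ fun p _ => by positivity]
    congr 2
    have h1 : ∏ p ∈ F, ((p : ℕ) : ℝ) ^ n.factorization p =
        ((∏ p ∈ n.primeFactors, p ^ n.factorization p : ℕ) : ℝ) := by
      push_cast
      exact Finset.prod_subtype_of_mem (fun p : ℕ => (p : ℝ) ^ n.factorization p)
        fun p hp => Nat.prime_of_mem_primeFactors hp
    rw [h1]
    exact_mod_cast Nat.prod_factorization_pow_eq_self hn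

theorem exists_isMuTilde (β : ℝ) (hβ : 1 ≤ β) : ∃ μ : Measure OmegaTildeB, IsMuTilde β μ := by
  obtain ⟨Λ, hΛ1, hΛ⟩ := exists_adele_measure
  obtain ⟨Θ, _, ν, _, a, ham, ha⟩ := exists_random_divisor (β - 1) (by linarith)
  have hfin : IsFiniteMeasure (Λ.restrict zHat) := ⟨by
    rw [Measure.restrict_apply_univ, hΛ1]; exact ENNReal.one_lt_top⟩
  let f : FinAdele × Θ → OmegaTildeB := fun x => OmegaTildeB.mk x.1 (cls (a x.2))
  have hpre : ∀ g, f ⁻¹' cell g =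
      {x | MemMul g.k (x - diag g.m)} ×ˢ {θ | MemMul g.k (a θ)} := fun g => by
    ext x
    simp [f, mk_mem_cell]
  have hf : Measurable f := measurable_of_cell fun g => by
    rw [hpre]
    exact (measurableSet_memMul _ _).prod (ham _ g.k_pos)
  have := Measure.isFiniteMeasure_map ((Λ.restrict zHat).prod ν) f
  refine exists_isMuTilde_of_finite (((Λ.restrict zHat).prod ν).map f) fun g hg => ?_
  -- A cell contains its own centre (m, k), so containment in Ω_B forces k to be a positive integer.
  have hmem : OmegaTildeB.mk (diag g.m) (cls (diag g.k)) ∈ cell g := by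
    rw [mk_mem_cell, sub_self, memMul_diag g.k_pos.ne']
    exact ⟨by simp [MemMul], 1, by simp⟩
  have hk := diag_mem_zHat.1 (mk_mem_omegaB.1 (hg hmem)).2
  obtain ⟨z, hz⟩ := hk
  have hz0 : 0 < z := by
    have := g.k_pos
    rw [hz] at this
    exact_mod_cast this
  lift z to ℕ using hz0.le
  have hn : z ≠ 0 := by rintro rfl; exact lt_irrefl _ hz0
  have hzk : g.k = (z : ℚ) := by rw [hz]; rfl
  -- The adele 0 lies in every kẐ, so every such x occurs as the first coordinate of a point of the
  -- cell.
  have hsub : {x : FinAdele | MemMul g.k (x - diag g.m)} ⊆ zHat := fun x hx =>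
    (mk_mem_omegaB.1 (hg (mk_mem_cell.2 ⟨hx, (by simp [MemMul] : MemMul g.k 0)⟩))).1
  have hz1 : (0 : ℝ) < z := by positivity
  rw [Measure.map_apply hf (measurableSet_cell g), hpre, Measure.prod_prod,
    Measure.restrict_apply (measurableSet_memMul _ _), inter_eq_left.2 hsub, hzk, hΛ z _ hn,
    ha z hn, ← ENNReal.ofReal_mul (by positivity), scale, hzk]
  congr 1
  rw [← Real.rpow_neg_one, ← Real.rpow_add hz1, Rat.cast_natCast]
  congr 1
  ring

/-! ### Divisibility events in Ω_B -/

theorem MemMul.mem_zHat {n : ℕ} (hn : n ≠ 0) {x : FinAdele} (h : MemMul n x) : x ∈ zHat := by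
  have := mul_mem (diag_nat_mem n) h
  rwa [← mul_assoc, ← map_mul, mul_inv_cancel₀ (by exact_mod_cast hn), map_one, one_mul] at this

/-- The part `{(r, a) | a ∈ n Ẑ}` of `Ω_B`. -/
def divSet (n : ℕ) : Set OmegaTildeB :=
  {ω | ∃ r a, r ∈ zHat ∧ MemMul n a ∧ ω = OmegaTildeB.mk r (cls a)}

theorem mk_mem_divSet {n : ℕ} (hn : n ≠ 0) {r a : FinAdele} :
    OmegaTildeB.mk r (cls a) ∈ divSet n ↔ r ∈ zHat ∧ MemMul n a := by
  refine ⟨?_, fun h => ⟨r, a, h.1, h.2, rfl⟩⟩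
  rintro ⟨r', a', hr', ha', h⟩
  have hn' : (n : ℚ) ≠ 0 := by exact_mod_cast hn
  have h1 : OmegaTildeB.mk r (cls a) ∈ omegaB := by
    rw [h]; exact mk_mem_omegaB.2 ⟨hr', ha'.mem_zHat hn⟩
  refine ⟨(mk_mem_omegaB.1 h1).1, (memMul_iff_norm hn').2 fun p => ?_⟩
  rw [(mk_eq_mk.1 h).1 p]
  exact (memMul_iff_norm hn').1 ha' p

theorem divSet_subset {n : ℕ} (hn : n ≠ 0) : divSet n ⊆ omegaB := by
  rintro _ ⟨r, a, hr, ha, rfl⟩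
  exact mk_mem_omegaB.2 ⟨hr, ha.mem_zHat hn⟩

theorem divSet_eq_biUnion {n : ℕ} (hn : 0 < n) :
    divSet n = ⋃ j ∈ Finset.range n, cell (aff (j : ℕ) n (by exact_mod_cast hn)) := by
  ext ω
  obtain ⟨r, a, rfl⟩ := exists_mk_eq ω
  rw [mk_mem_divSet hn.ne', mem_zHat_iff_exists_coset hn.ne']
  simp only [mem_iUnion, Finset.mem_range, exists_prop, mk_mem_cell, aff_m, aff_k]
  tauto

theorem measurableSet_divSet {n : ℕ} (hn : n ≠ 0) : MeasurableSet (divSet n) := by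
  rw [divSet_eq_biUnion (Nat.pos_of_ne_zero hn)]
  exact Finset.measurableSet_biUnion _ fun j _ => measurableSet_cell _

theorem measurableSet_omegaB : MeasurableSet omegaB := cell_one ▸ measurableSet_cell 1

/-- The event splits into n disjoint cells, one for each residue of r modulo n, of mass n^{-β} each.
-/
theorem IsMuTilde.divSet {μ : Measure OmegaTildeB} (hμ : IsMuTilde β μ) {n : ℕ} (hn : n ≠ 0) :
    μ (divSet n) = ENNReal.ofReal ((n : ℝ) ^ (1 - β)) := by
  have hn0 : 0 < n := Nat.pos_of_ne_zero hn
  rw [divSet_eq_biUnion hn0, measure_biUnion_finset ?_ fun j _ => measurableSet_cell _]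
  · simp only [hμ.cell, scale, aff_k]
    rw [Finset.sum_const, Finset.card_range, nsmul_eq_mul, ← ENNReal.ofReal_natCast,
      ← ENNReal.ofReal_mul (by positivity), Rat.cast_natCast, sub_eq_add_neg,
      Real.rpow_add (by positivity), Real.rpow_one]
  · intro i hi j hj hij
    refine disjoint_left.2 fun ω hωi hωj => hij ?_
    obtain ⟨r, a, rfl⟩ := exists_mk_eq ω
    exact eq_of_mem_cosets (by simpa using hi) (by simpa using hj) (mk_mem_cell.1 hωi).1
      (mk_mem_cell.1 hωj).1

theorem IsMuTilde.isProbabilityMeasure {μ : Measure OmegaTildeB} (hμ : IsMuTilde β μ) :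
    IsProbabilityMeasure (μ.restrict omegaB) :=
  ⟨by rw [Measure.restrict_apply_univ, hμ.normalized]⟩

/-- An invariant property that holds almost everywhere on `Ω_B` holds almost everywhere. -/
theorem IsMuTilde.ae_of_ae_restrict {μ : Measure OmegaTildeB} (hμ : IsMuTilde β μ)
    {P : OmegaTildeB → Prop} (hinv : ∀ (g : AffQ) ω, P (g • ω) → P ω)
    (h : ∀ᵐ ω ∂μ.restrict omegaB, P ω) : ∀ᵐ ω ∂μ, P ω := by
  rw [ae_restrict_iff' measurableSet_omegaB] at h
  have h' : ∀ᵐ ω ∂μ, ∀ g : AffQ, g • ω ∈ omegaB → P (g • ω) :=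
    ae_all_iff.2 fun g => (hμ.quasiMeasurePreserving g).ae h
  filter_upwards [h'] with ω hω
  have hcov : ω ∈ ⋃ N, ToeplitzAffine.cell (facInv N) := by rw [iUnion_cell_facInv]; trivial
  obtain ⟨N, hN⟩ := mem_iUnion.1 hcov
  exact hinv _ _ (hω _ hN)

/-! ### Points with trivial stabilizer -/

theorem smul_mk_cls (g : AffQ) (r a : FinAdele) :
    g • OmegaTildeB.mk r (cls a) =
      OmegaTildeB.mk (diag g.m + diag g.k * r) (cls (diag g.k * a)) := rfl

theorem stabilizer_eq_bot_iff {ω : OmegaTildeB} :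
    MulAction.stabilizer AffQ ω = ⊥ ↔ ∀ g : AffQ, g • ω = ω → g = 1 := by
  rw [Subgroup.eq_bot_iff_forall]
  rfl

theorem stabilizer_eq_bot_smul {g : AffQ} {ω : OmegaTildeB}
    (h : MulAction.stabilizer AffQ (g • ω) = ⊥) : MulAction.stabilizer AffQ ω = ⊥ := by
  rw [stabilizer_eq_bot_iff] at h ⊢
  intro x hx
  have := h (g * x * g⁻¹) (by rw [mul_smul, inv_smul_smul, mul_smul, hx])
  exact conj_eq_one_iff.1 this

/-- Points `(r, a)` with `a` nowhere zero and divisible by infinitely many integers have trivial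
stabilizer. -/
theorem stabilizer_eq_bot_of_frequently {r a : FinAdele} (ha : ∀ p, a p ≠ 0)
    (hdiv : ∃ᶠ n : ℕ in Filter.atTop, MemMul n a) :
    MulAction.stabilizer AffQ (OmegaTildeB.mk r (cls a)) = ⊥ := by
  rw [stabilizer_eq_bot_iff]
  intro g hg
  rw [smul_mk_cls, mk_eq_mk] at hg
  obtain ⟨h1, h2⟩ := hg
  have hk : ∀ p : Nat.Primes, ‖(g.k : ℚ_[(p : ℕ)])‖ = 1 := fun p => by
    have h := h1 p
    change ‖(g.k : ℚ_[(p : ℕ)]) * a p‖ = ‖a p‖ at h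
    rw [norm_mul] at h
    exact (mul_eq_right₀ (norm_ne_zero_iff.2 (ha p))).1 h
  -- A rational of norm 1 at all primes is an integer with integral inverse; positivity leaves only
  -- 1.
  have hk1 : g.k = 1 := by
    obtain ⟨z, hz⟩ := diag_mem_zHat.1 (fun p => (hk p).le : diag g.k ∈ zHat)
    obtain ⟨w, hw⟩ := diag_mem_zHat.1 (fun p => by
      change ‖((g.k⁻¹ : ℚ) : ℚ_[(p : ℕ)])‖ ≤ 1
      rw [Rat.cast_inv, norm_inv, hk p, inv_one] : diag g.k⁻¹ ∈ zHat)
    have hzw : z * w = 1 := by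
      have := mul_inv_cancel₀ g.k_pos.ne'
      rw [hw, hz] at this
      exact_mod_cast this
    have hz0 : 0 < z := by
      have := g.k_pos
      rw [hz] at this
      exact_mod_cast this
    rcases Int.eq_one_or_neg_one_of_mul_eq_one hzw with h | h
    · rw [hz, h, Int.cast_one]
    · omega
  refine affQ_ext ?_ hk1
  rw [AffQ.one_m]
  by_contra hm
  have hma : ∀ p : Nat.Primes, ‖(g.m : ℚ_[(p : ℕ)])‖ ≤ ‖a p‖ := fun p => by
    have h := h2 p
    change ‖(g.m : ℚ_[(p : ℕ)]) + (g.k : ℚ_[(p : ℕ)]) * r p - r p‖ ≤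
      ‖(g.k : ℚ_[(p : ℕ)]) * a p‖ at h
    rwa [hk1, Rat.cast_one, one_mul, one_mul, add_sub_cancel_right] at h
  -- A divisor n of a exceeding |m| must divide m, which is impossible for m ≠ 0.
  obtain ⟨N, hN⟩ := exists_nat_gt |g.m|
  obtain ⟨n, hnN, hn⟩ := Filter.frequently_atTop.1 hdiv (N + 1)
  have hn0 : (n : ℚ) ≠ 0 := by exact_mod_cast (by omega : n ≠ 0)
  have hmn : MemMul n (diag g.m) := (memMul_iff_norm hn0).2 fun p =>
    (hma p).trans ((memMul_iff_norm hn0).1 hn p)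
  obtain ⟨z, hz⟩ := (memMul_diag hn0).1 hmn
  have hz0 : z ≠ 0 := by rintro rfl; exact hm (by simpa using hz)
  have hz1 : (1 : ℚ) ≤ |(z : ℚ)| := by exact_mod_cast Int.one_le_abs hz0
  have hNn : (N : ℚ) < n := by exact_mod_cast hnN
  rw [hz, abs_mul, Nat.abs_cast] at hN
  nlinarith [(Nat.cast_nonneg n : (0 : ℚ) ≤ n)]

/-- Points `(r, 0)` with `r` irrational have trivial stabilizer. -/
theorem stabilizer_eq_bot_of_irrational {r : FinAdele} (hr : ∀ q, r ≠ diag q) :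
    MulAction.stabilizer AffQ (OmegaTildeB.mk r (cls 0)) = ⊥ := by
  rw [stabilizer_eq_bot_iff]
  intro g hg
  rw [smul_mk_cls, mk_eq_mk] at hg
  have h : diag g.m + diag g.k * r = r := by
    ext p
    have h := hg.2 p
    rw [mul_zero] at h
    change _ ≤ ‖(0 : ℚ_[(p : ℕ)])‖ at h
    rwa [norm_zero, norm_le_zero_iff, sub_eq_zero] at h
  -- For k ≠ 1 the only fixed point of r ↦ m + kr is the rational m/(1 - k).
  have hk : g.k = 1 := by
    by_contra hk
    have hk' : 1 - g.k ≠ 0 := sub_ne_zero.2 (Ne.symm hk)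
    refine hr (g.m / (1 - g.k)) ?_
    have h1 : diag (1 - g.k) * r = diag g.m := by
      rw [map_sub, map_one]
      linear_combination -h
    rw [div_eq_inv_mul, map_mul, ← h1, ← mul_assoc, ← map_mul, inv_mul_cancel₀ hk', map_one,
      one_mul]
  refine affQ_ext (diag_injective ?_) hk
  rw [hk, map_one, one_mul, add_eq_right] at h
  rw [h, AffQ.one_m, map_zero]

/-! ### Independence, Borel–Cantelli and essential freeness -/

theorem memMul_mul_iff_of_coprime {m n : ℕ} (h : m.Coprime n) (hm : m ≠ 0) (hn : n ≠ 0)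
    {x : FinAdele} : MemMul ((m * n : ℕ) : ℚ) x ↔ MemMul m x ∧ MemMul n x := by
  rw [memMul_iff_norm (by exact_mod_cast mul_ne_zero hm hn),
    memMul_iff_norm (by exact_mod_cast hm), memMul_iff_norm (by exact_mod_cast hn),
    ← forall_and]
  refine forall_congr' fun p => ?_
  rw [Rat.cast_natCast, Rat.cast_natCast, Rat.cast_natCast, Nat.cast_mul, norm_mul]
  have hm1 := norm_nat_le p m
  have hn1 := norm_nat_le p n
  by_cases hp : (p : ℕ) ∣ m
  · have hpn : ‖(n : ℚ_[(p : ℕ)])‖ = 1 :=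
      Padic.norm_natCast_eq_one_iff.2 (Nat.Coprime.coprime_dvd_left hp h)
    rw [hpn, mul_one]
    exact ⟨fun h => ⟨h, h.trans hm1⟩, fun h => h.1⟩
  · have hpm : ‖(m : ℚ_[(p : ℕ)])‖ = 1 :=
      Padic.norm_natCast_eq_one_iff.2 ((Nat.Prime.coprime_iff_not_dvd p.2).2 hp)
    rw [hpm, one_mul]
    exact ⟨fun h => ⟨h.trans hn1, h⟩, fun h => h.2⟩

theorem memMul_prod_primes_iff {F : Finset ℕ} (hF : ∀ p ∈ F, p.Prime) {x : FinAdele} :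
    MemMul ((∏ p ∈ F, p : ℕ) : ℚ) x ↔ x ∈ zHat ∧ ∀ p ∈ F, MemMul p x := by
  induction F using Finset.induction_on with
  | empty => simp [MemMul]
  | insert p F hp ih =>
    have hF' : ∀ q ∈ F, q.Prime := fun q hq => hF q (Finset.mem_insert_of_mem hq)
    have hpp : p.Prime := hF p (Finset.mem_insert_self _ _)
    have hco : p.Coprime (∏ q ∈ F, q) := Nat.Coprime.prod_right fun q hq =>
      (Nat.coprime_primes hpp (hF' q hq)).2 fun h => hp (h ▸ hq)
    rw [Finset.prod_insert hp, memMul_mul_iff_of_coprime hco hpp.ne_zero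
      (Finset.prod_ne_zero_iff.2 fun q hq => (hF' q hq).ne_zero), ih hF']
    simp only [Finset.forall_mem_insert]
    tauto

open Classical in
/-- The event that `a` is divisible by `n`, for prime `n`. -/
def primeEvent (n : ℕ) : Set OmegaTildeB := if n.Prime then divSet n else ∅

theorem primeEvent_of_prime {n : ℕ} (hn : n.Prime) : primeEvent n = divSet n := if_pos hn

theorem primeEvent_of_not_prime {n : ℕ} (hn : ¬ n.Prime) : primeEvent n = ∅ := if_neg hn

theorem measurableSet_primeEvent (n : ℕ) : MeasurableSet (primeEvent n) := by
  by_cases hn : n.Prime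
  · rw [primeEvent_of_prime hn]; exact measurableSet_divSet hn.ne_zero
  · rw [primeEvent_of_not_prime hn]; exact MeasurableSet.empty

theorem IsMuTilde.restrict_divSet {μ : Measure OmegaTildeB} (hμ : IsMuTilde β μ) {n : ℕ}
    (hn : n ≠ 0) :
    μ.restrict omegaB (ToeplitzAffine.divSet n) = ENNReal.ofReal ((n : ℝ) ^ (1 - β)) := by
  rw [Measure.restrict_apply (measurableSet_divSet hn), inter_eq_left.2 (divSet_subset hn),
    hμ.divSet hn]

/-- Divisibility by distinct primes is divisibility by their product, and n^{1-β} is multiplicative.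
A non-prime index contributes the empty event, making both sides 0. -/
theorem IsMuTilde.iIndepSet_primeEvent {μ : Measure OmegaTildeB} (hμ : IsMuTilde β μ) :
    ProbabilityTheory.iIndepSet primeEvent (μ.restrict omegaB) := by
  rw [ProbabilityTheory.iIndepSet_iff_meas_biInter measurableSet_primeEvent]
  intro F
  by_cases hF : ∀ p ∈ F, p.Prime
  · have hn : ∏ p ∈ F, p ≠ 0 := Finset.prod_ne_zero_iff.2 fun p hp => (hF p hp).ne_zero
    have hset : (⋂ p ∈ F, primeEvent p) ∩ omegaB = ToeplitzAffine.divSet (∏ p ∈ F, p) := by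
      ext ω
      obtain ⟨r, a, rfl⟩ := exists_mk_eq ω
      rw [mem_inter_iff, mk_mem_divSet hn, memMul_prod_primes_iff hF, mk_mem_omegaB]
      have h : ∀ p ∈ F, (OmegaTildeB.mk r (cls a) ∈ primeEvent p ↔ r ∈ zHat ∧ MemMul p a) :=
        fun p hp => by rw [primeEvent_of_prime (hF p hp), mk_mem_divSet (hF p hp).ne_zero]
      simp only [mem_iInter]
      constructor
      · rintro ⟨h1, h2, h3⟩
        exact ⟨h2, h3, fun p hp => ((h p hp).1 (h1 p hp)).2⟩
      · rintro ⟨h1, h2, h3⟩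
        exact ⟨fun p hp => (h p hp).2 ⟨h1, h3 p hp⟩, h1, h2⟩
    rw [Measure.restrict_apply (Finset.measurableSet_biInter _ fun p _ =>
      measurableSet_primeEvent p), hset, hμ.divSet hn]
    have hterm : ∀ p ∈ F, μ.restrict omegaB (primeEvent p) =
        ENNReal.ofReal ((p : ℝ) ^ (1 - β)) := fun p hp => by
      rw [primeEvent_of_prime (hF p hp), hμ.restrict_divSet (hF p hp).ne_zero]
    rw [Finset.prod_congr rfl hterm, ← ENNReal.ofReal_prod_of_nonneg fun p _ => by positivity,
      Real.finsetProd_rpow _ _ fun p _ => by positivity, Nat.cast_prod]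
  · push Not at hF
    obtain ⟨p, hp, hpp⟩ := hF
    have h0 := primeEvent_of_not_prime hpp
    rw [Finset.prod_eq_zero hp (by rw [h0, measure_empty])]
    exact measure_mono_null (biInter_subset_of_mem hp) (by rw [h0, measure_empty])

/-- For β ≤ 2 the terms p^{1-β} dominate 1/p, whose sum over the primes diverges. -/
theorem IsMuTilde.tsum_primeEvent {μ : Measure OmegaTildeB} (hμ : IsMuTilde β μ) (hβ : β ≤ 2) :
    ∑' n, μ.restrict omegaB (primeEvent n) = ⊤ := by
  by_contra h
  refine not_summable_one_div_on_primes ((ENNReal.summable_toReal h).of_nonneg_of_le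
    (fun n => indicator_nonneg (fun n _ => by positivity) n) fun n => ?_)
  by_cases hn : n.Prime
  · rw [indicator_of_mem (show n ∈ {p : ℕ | p.Prime} from hn), primeEvent_of_prime hn,
      hμ.restrict_divSet hn.ne_zero, ENNReal.toReal_ofReal (by positivity), one_div,
      ← Real.rpow_neg_one]
    exact Real.rpow_le_rpow_of_exponent_le (by exact_mod_cast hn.one_lt.le) (by linarith)
  · rw [indicator_of_notMem (show n ∉ {p : ℕ | p.Prime} from hn)]
    exact ENNReal.toReal_nonneg

/-- The events that `a` is divisible by a given prime are independent with divergent sum of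
probabilities, so infinitely many of them occur. -/
theorem IsMuTilde.ae_frequently {μ : Measure OmegaTildeB} (hμ : IsMuTilde β μ) (hβ : β ≤ 2) :
    ∀ᵐ ω ∂μ.restrict omegaB, ∃ᶠ n in Filter.atTop, ω ∈ primeEvent n := by
  have := hμ.isProbabilityMeasure
  have h := ProbabilityTheory.measure_limsup_eq_one measurableSet_primeEvent
    hμ.iIndepSet_primeEvent (hμ.tsum_primeEvent hβ)
  have h' := (mem_ae_iff_prob_eq_one
    (MeasurableSet.measurableSet_limsup measurableSet_primeEvent)).2 h
  filter_upwards [h'] with ω hω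
  exact Filter.mem_limsup_iff_frequently_mem.1 hω

/-- The masses p^{i(1-β)} tend to 0 since β > 1. This makes a nonzero at p almost surely. -/
theorem IsMuTilde.ae_notMem_divSet_pow {μ : Measure OmegaTildeB} (hμ : IsMuTilde β μ)
    (hβ : 1 < β) (p : Nat.Primes) :
    ∀ᵐ ω ∂μ.restrict omegaB, ∃ i : ℕ, ω ∉ ToeplitzAffine.divSet ((p : ℕ) ^ i) := by
  rw [ae_iff]
  push Not
  have hle : ∀ i : ℕ, μ.restrict omegaB {ω | ∀ i : ℕ, ω ∈ ToeplitzAffine.divSet ((p : ℕ) ^ i)} ≤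
      ENNReal.ofReal ((((p : ℕ) : ℝ) ^ (1 - β)) ^ i) := fun i => by
    have hsub : {ω | ∀ i : ℕ, ω ∈ ToeplitzAffine.divSet ((p : ℕ) ^ i)} ⊆
        ToeplitzAffine.divSet ((p : ℕ) ^ i) := fun ω hω => hω i
    refine (measure_mono hsub).trans_eq ?_
    rw [hμ.restrict_divSet (pow_ne_zero _ p.2.ne_zero), Nat.cast_pow, ← Real.rpow_natCast,
      ← Real.rpow_natCast, ← Real.rpow_mul (by positivity), ← Real.rpow_mul (by positivity),
      mul_comm]
  have hlim := ENNReal.tendsto_ofReal (tendsto_pow_atTop_nhds_zero_of_lt_one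
    (by positivity : 0 ≤ ((p : ℕ) : ℝ) ^ (1 - β))
    (Real.rpow_lt_one_of_one_lt_of_neg (by exact_mod_cast p.2.one_lt) (by linarith)))
  rw [ENNReal.ofReal_zero] at hlim
  exact le_antisymm (ge_of_tendsto' hlim hle) zero_le

theorem memMul_prime_pow {a : FinAdele} (ha : a ∈ zHat) (p : Nat.Primes) (i : ℕ)
    (hp : ‖a p‖ ≤ ((p : ℕ) : ℝ)⁻¹ ^ i) : MemMul (((p : ℕ) ^ i : ℕ) : ℚ) a := by
  refine (memMul_iff_norm (by exact_mod_cast pow_ne_zero _ p.2.ne_zero)).2 fun q => ?_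
  rw [Rat.cast_natCast, Nat.cast_pow, norm_pow]
  by_cases hq : q = p
  · subst hq
    rwa [Padic.norm_p]
  · have h1 : ‖((p : ℕ) : ℚ_[(q : ℕ)])‖ = 1 :=
      Padic.norm_natCast_eq_one_iff.2
        ((Nat.coprime_primes q.2 p.2).2 fun h => hq (Subtype.ext h))
    rw [h1, one_pow]
    exact ha q

theorem eq_zero_of_forall_memMul {a : FinAdele} (h : ∀ n : ℕ, n ≠ 0 → MemMul n a) : a = 0 := by
  ext p
  have hle : ∀ i : ℕ, ‖a p‖ ≤ ((p : ℕ) : ℝ)⁻¹ ^ i := fun i => by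
    have h0 : (p : ℕ) ^ i ≠ 0 := pow_ne_zero _ p.2.ne_zero
    have := (memMul_iff_norm (by exact_mod_cast h0)).1 (h _ h0) p
    rwa [Rat.cast_natCast, Nat.cast_pow, norm_pow, Padic.norm_p] at this
  have hlim := tendsto_pow_atTop_nhds_zero_of_lt_one
    (by positivity : 0 ≤ ((p : ℕ) : ℝ)⁻¹)
    (inv_lt_one_of_one_lt₀ (by exact_mod_cast p.2.one_lt))
  exact norm_le_zero_iff.1 (ge_of_tendsto' hlim hle)

theorem IsMuTilde.ae_stabilizer_of_one_lt {μ : Measure OmegaTildeB} (hμ : IsMuTilde β μ)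
    (hβ : 1 < β) (hβ2 : β ≤ 2) :
    ∀ᵐ ω ∂μ.restrict omegaB, MulAction.stabilizer AffQ ω = ⊥ := by
  filter_upwards [hμ.ae_frequently hβ2, ae_all_iff.2 (hμ.ae_notMem_divSet_pow hβ),
    ae_restrict_mem measurableSet_omegaB] with ω h1 h2 h3
  obtain ⟨r, a, rfl⟩ := exists_mk_eq ω
  obtain ⟨hr, ha⟩ := mk_mem_omegaB.1 h3
  refine stabilizer_eq_bot_of_frequently (fun p hp => ?_) (h1.mono fun n hn => ?_)
  · obtain ⟨i, hi⟩ := h2 p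
    refine hi ((mk_mem_divSet (pow_ne_zero _ p.2.ne_zero)).2 ⟨hr, memMul_prime_pow ha p i ?_⟩)
    rw [hp, norm_zero]
    positivity
  · by_cases hpr : n.Prime
    · rw [primeEvent_of_prime hpr] at hn
      exact ((mk_mem_divSet hpr.ne_zero).1 hn).2
    · rw [primeEvent_of_not_prime hpr] at hn
      exact hn.elim

/-- The point lies in the cells of (q, 2^i), whose masses 2^{-iβ} tend to 0. -/
theorem IsMuTilde.measure_singleton_rat {μ : Measure OmegaTildeB} (hμ : IsMuTilde β μ)
    (hβ : 0 < β) (q : ℚ) : μ {OmegaTildeB.mk (diag q) (cls 0)} = 0 := by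
  have hle : ∀ i : ℕ, μ {OmegaTildeB.mk (diag q) (cls 0)} ≤
      ENNReal.ofReal (((2 : ℝ) ^ (-β)) ^ i) := fun i => by
    have hmem : OmegaTildeB.mk (diag q) (cls 0) ∈
        ToeplitzAffine.cell (aff q (2 ^ i) (by positivity)) := by
      rw [mk_mem_cell]
      simp [MemMul]
    refine (measure_mono (singleton_subset_iff.2 hmem)).trans_eq ?_
    rw [hμ.cell, scale, aff_k]
    push_cast
    rw [← Real.rpow_natCast, ← Real.rpow_natCast, ← Real.rpow_mul (by positivity),
      ← Real.rpow_mul (by positivity), mul_comm]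
  have hlim := ENNReal.tendsto_ofReal (tendsto_pow_atTop_nhds_zero_of_lt_one
    (by positivity : 0 ≤ (2 : ℝ) ^ (-β))
    (Real.rpow_lt_one_of_one_lt_of_neg one_lt_two (by linarith)))
  rw [ENNReal.ofReal_zero] at hlim
  exact le_antisymm (ge_of_tendsto' hlim hle) zero_le

/-- At β = 1 each divisibility event has full mass in Ω_B, so a = 0 almost surely; the countably
many points with rational r are null. -/
theorem IsMuTilde.ae_stabilizer_of_eq_one {μ : Measure OmegaTildeB} (hμ : IsMuTilde 1 μ) :
    ∀ᵐ ω ∂μ.restrict omegaB, MulAction.stabilizer AffQ ω = ⊥ := by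
  have := hμ.isProbabilityMeasure
  have h1 : ∀ᵐ ω ∂μ.restrict omegaB, ∀ n : ℕ, n ≠ 0 → ω ∈ ToeplitzAffine.divSet n := by
    refine ae_all_iff.2 fun n => ?_
    by_cases hn : n = 0
    · exact Filter.Eventually.of_forall fun _ h => absurd hn h
    · have h := (mem_ae_iff_prob_eq_one (μ := μ.restrict omegaB) (measurableSet_divSet hn)).2
        (by rw [hμ.restrict_divSet hn, sub_self, Real.rpow_zero, ENNReal.ofReal_one])
      filter_upwards [h] with ω hω _ using hω
  have h2 : ∀ᵐ ω ∂μ.restrict omegaB, ∀ q : ℚ, ω ≠ OmegaTildeB.mk (diag q) (cls 0) :=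
    ae_all_iff.2 fun q => ae_restrict_of_ae
      (compl_mem_ae_iff.2 (hμ.measure_singleton_rat one_pos q))
  filter_upwards [h1, h2] with ω h1 h2
  obtain ⟨r, a, rfl⟩ := exists_mk_eq ω
  obtain rfl : a = 0 := eq_zero_of_forall_memMul fun n hn => ((mk_mem_divSet hn).1 (h1 n hn)).2
  exact stabilizer_eq_bot_of_irrational fun q hq => h2 q (by rw [hq])

theorem IsMuTilde.isEssentiallyFree {μ : Measure OmegaTildeB} (hμ : IsMuTilde β μ)
    (hβ : β ∈ Icc (1 : ℝ) 2) : IsEssentiallyFree AffQ μ := by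
  refine hμ.ae_of_ae_restrict (fun g ω => stabilizer_eq_bot_smul) ?_
  rcases hβ.1.eq_or_lt with rfl | h1
  · exact hμ.ae_stabilizer_of_eq_one
  · exact hμ.ae_stabilizer_of_one_lt h1 hβ.2

end ToeplitzAffine

end

theorem lemma3p1 (β : ℝ) (hβ : β ∈ Set.Icc (1 : ℝ) 2) :
    ∃ μ : MeasureTheory.Measure ToeplitzAffine.OmegaTildeB,
      (ToeplitzAffine.IsMuTilde β μ ∧
        ∀ μ' : MeasureTheory.Measure ToeplitzAffine.OmegaTildeB,
          ToeplitzAffine.IsMuTilde β μ' → μ' = μ) ∧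
      ToeplitzAffine.IsErgodicAction ToeplitzAffine.AffQ μ ∧
      ToeplitzAffine.IsEssentiallyFree ToeplitzAffine.AffQ μ := by
  obtain ⟨μ, hμ⟩ := ToeplitzAffine.exists_isMuTilde β hβ.1
  exact ⟨μ, ⟨hμ, fun μ' hμ' => hμ'.unique hμ⟩, hμ.isErgodicAction, hμ.isEssentiallyFree hβ⟩
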